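/- **Setting.** Let $\Pi_1,\dots,\Pi_M$ be finite nonempty classes of (measurable) policies $\pi:\mathcal X\to[K]$ on an arbitrary context space $\mathcal X$ (nested or not), and let $T$ be the horizon. In each round $t=1,\dots,T$ the adversary prepares a context $x_t\in\mathcal X$ and a loss vector $\ell_t\in[0,1]^K$, the learner observes $x_t$, plays an arm $A_t\in[K]$ and observes $\ell_{t,A_t}$ only. The adversary is adaptive: $(x_t,\ell_t)$ may be random and may depend on everything that happened before round $t$. The pseudo-regret against a finite policy class $\Pi$ is $\mathrm{Reg}(T,\Pi)=\max_{\pi\in\Pi}\mathbb E\big[\sum_{t=1}^T(\ell_{t,A_t}-\ell_{t,\pi(x_t)})\big]$. **Algorithm (Hedged-FTRL over $M$ instances of EXP4).** The tuning parameters are a step size $\eta>0$, numbers $R_m\ge0$ and $0<\beta_m\le 1/M$, and for each $m$ a learning rate $\gamma_m(\rho)>0$, which is a measurable function of $\rho>0$. Let $\Delta$ be the probability simplex in $\mathbb R^M$, and let $\mathbf e_m$ be the unit vectors. * In round $t$ put $q_t=\arg\min_{q\in\Delta}\ \langle q,\hat L_{t-1}-B_{t-1}\rangle-\frac2\eta\sum_{i}\sqrt{q_i}$,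 where $\hat L_0=B_0=0$, and $\rho_{t,m}^{-1}=\min\{\beta_m,\min_{s\le t}q_{s,m}\}$. * Draw $M_t\sim q_t$. The instance $M_t=m$ of EXP4 plays $A_t$ from $p_{t,m}(a\mid x_t)=\sum_{\pi\in\Pi_m:\,\pi(x_t)=a}w_{t,m}(\pi)$, where $w_{t,m}(\pi)$ is proportional over $\pi\in\Pi_m$ to $\exp(-\gamma_m(\rho_{t,m})\,S_{t-1,m}(\pi))$, with $S_{0,m}=0$. * Update $\hat L_t=\hat L_{t-1}+\mathbf e_{M_t}\,\ell_{t,A_t}/q_{t,M_t}$. For the selected instance $m=M_t$ only, feed the loss $\ell_{t,A_t}/q_{t,m}$ to EXP4: $S_{t,m}(\pi)=S_{t-1,m}(\pi)+\frac{\mathbf 1\{\pi(x_t)=A_t\}}{p_{t,m}(A_t\mid x_t)}\cdot\frac{\ell_{t,A_t}}{q_{t,m}}$. * Put $B_t=B_{t-1}+b_t\,\mathbf e_{M_t}$, where the bias $b_t\ge0$ is determined by the requirement that $\sqrt{\rho_{1,m}}\,R_m+B_{t,m}=\sqrt{\rho_{t+1,m}}\,R_m$ for all $m\in[M]$ (here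 $\rho_{t+1}$ depends on $b_t$ through $q_{t+1}$). **Theorem.** There are universal constants $C>0$ and $d\in\mathbb N$ such that for all $K,M,T$, all $\mathfrak C>0$ and all $\Pi_1,\dots,\Pi_M$ as above there is a choice of the tuning parameters, which does not depend on the adversary, such that against every adaptive adversary, on both contexts and losses, the algorithm satisfies $$\mathrm{Reg}(T,\Pi_m)\ \le\ C\,(1+\ln T+\ln K)^d\,\max\Big\{\mathfrak C,\frac{\ln|\Pi_m|}{\mathfrak C}\Big\}\sqrt{MKT}$$ simultaneously for all $m\in[M]$ with $|\Pi_m|\ge2$, and, if $\mathfrak C\ge1$, for all $m\in[M]$. (That is, $\mathrm{Reg}(T,\Pi_m)=\tilde O\big(\max\{\mathfrak C,\ln|\Pi_m|/\mathfrak C\}\sqrt{MKT}\big)$ uniformly in $m$, where $\tilde O$ hides factors polylogarithmic in $T$ and $K$ but not in $|\Pi_m|$.) -/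

import Mathlib

open MeasureTheory

namespace HedgedBandit

/-- What the learner records in one round: the context, the index of the base algorithm that was
selected, the arm that was played, and the loss of that arm. -/
structure Round (X : Type*) (K M : ℕ) where
  ctx : X
  base : Fin M
  arm : Fin K
  loss : ℝ

/-- The tuning parameters of Hedged-FTRL over `M` instances of EXP4: the step size `η` of the top
algorithm, the regret parameters `R`, the thresholds `β` (at most `1 / M`, the initial selection
probability), and for each EXP4 instance its learning rate `lr m ρ`, as a function of the current
variance level `ρ` of the importance-weighted losses that are fed to it. -/
structure Tuning (M : ℕ) where
  η : ℝ
  R : Fin M → ℝ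
  β : Fin M → ℝ
  lr : Fin M → ℝ → ℝ
  η_pos : 0 < η
  R_nonneg : ∀ m, 0 ≤ R m
  β_pos : ∀ m, 0 < β m
  β_le : ∀ m, β m ≤ 1 / (M : ℝ)
  lr_pos : ∀ m ρ, 0 < ρ → 0 < lr m ρ
  lr_meas : ∀ m, Measurable (lr m)

/-- The potential `F(q) = -2 ∑ √qᵢ` (negative Tsallis entropy of order `1/2`, up to
an additive constant). -/
noncomputable def potential {M : ℕ} (q : Fin M → ℝ) : ℝ :=
  -2 * ∑ i, √(q i)

/-- The FTRL rule: the minimizer over the probability simplex of `⟨q, G⟩ + F(q) / η`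
(for `η > 0` and `M ≥ 1` it exists and is unique). -/
noncomputable def ftrl {M : ℕ} (η : ℝ) (G : Fin M → ℝ) : Fin M → ℝ :=
  Classical.epsilon fun q : Fin M → ℝ =>
    q ∈ stdSimplex ℝ (Fin M) ∧
      IsMinOn (fun p : Fin M → ℝ => ∑ i, p i * G i + potential p / η) (stdSimplex ℝ (Fin M)) q

/-- EXP4 with policy class `P`, learning rate `γ` and cumulative estimated policy losses `S`:
the probability of playing arm `a` when the context is `x`, that is, the mass of the policies that
recommend `a` under the exponential weights `exp (-γ S(π))`. -/
noncomputable def exp4Prob {X : Type*} {K : ℕ} (P : Finset (X → Fin K)) (γ : ℝ)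
    (S : (X → Fin K) → ℝ) (x : X) (a : Fin K) : ℝ :=
  (∑ π ∈ P with π x = a, Real.exp (-γ * S π)) / ∑ π ∈ P, Real.exp (-γ * S π)

/-- The state of Hedged-FTRL at the beginning of a round. -/
structure State (X : Type*) (K M : ℕ) where
  /-- cumulative importance-weighted losses of the base algorithms -/
  L : Fin M → ℝ
  /-- cumulative biases (without the initial term `B₀`) -/
  B : Fin M → ℝ
  /-- the reciprocals `ρ⁻¹` of the variance levels: the minimum of `β` and of all selection
  probabilities up to and including the current round -/
  rhoInv : Fin M → ℝ
  /-- for each base algorithm, the cumulative estimated losses of the policies -/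
  S : Fin M → (X → Fin K) → ℝ

section Algorithm

variable {X : Type*} {K M : ℕ}

/-- The selection probabilities `q` of the base algorithms in the current round. -/
noncomputable def State.q (τ : Tuning M) (s : State X K M) : Fin M → ℝ :=
  ftrl τ.η (s.L - s.B)

/-- The probability that base algorithm `m` plays arm `a` in the current round if it is selected
and the context is `x`. -/
noncomputable def State.baseProb (τ : Tuning M) (P : Fin M → Finset (X → Fin K))
    (s : State X K M) (m : Fin M) (x : X) (a : Fin K) : ℝ :=
  exp4Prob (P m) (τ.lr m (s.rhoInv m)⁻¹) (s.S m) x a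

/-- The state before the first round. -/
noncomputable def initState (τ : Tuning M) : State X K M where
  L := 0
  B := 0
  rhoInv := fun m => min (τ.β m) (ftrl τ.η (0 : Fin M → ℝ) m)
  S := 0

/-- The initial bias `B₀ = √ρ₁ R`. -/
noncomputable def initBias (τ : Tuning M) (m : Fin M) : ℝ :=
  √((initState τ : State X K M).rhoInv m)⁻¹ * τ.R m

/-- The cumulative importance-weighted losses of the base algorithms after the round `r`. -/
noncomputable def nextL (τ : Tuning M) (s : State X K M) (r : Round X K M) : Fin M → ℝ :=
  s.L + Pi.single r.base (r.loss / s.q τ r.base)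

/-- The next selection probabilities if the selected base receives the bias `b`. -/
noncomputable def nextQ (τ : Tuning M) (s : State X K M) (r : Round X K M) (b : ℝ) : Fin M → ℝ :=
  ftrl τ.η (nextL τ s r - (s.B + Pi.single r.base b))

/-- The next value of `ρ⁻¹` if the selected base receives the bias `b`. -/
noncomputable def nextRhoInv (τ : Tuning M) (s : State X K M) (r : Round X K M) (b : ℝ) :
    Fin M → ℝ :=
  fun m => min (s.rhoInv m) (nextQ τ s r b m)

/-- The bias given to the selected base: the `b ≥ 0` for which the cumulative biases, including the
initial ones, equal `√ρ R` for every base algorithm, where `ρ` is the variance level of the next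
round (and so depends on `b`). -/
noncomputable def bias (τ : Tuning M) (s : State X K M) (r : Round X K M) : ℝ :=
  Classical.epsilon fun b : ℝ => 0 ≤ b ∧ ∀ m,
    initBias (X := X) (K := K) τ m + (s.B m + Pi.single (M := fun _ : Fin M => ℝ) r.base b m) =
      √(nextRhoInv τ s r b m)⁻¹ * τ.R m

/-- The state after the round `r`. The selected EXP4 instance is updated with the
importance-weighted loss `loss / q`; the other instances are not updated. -/
noncomputable def nextState (τ : Tuning M) (P : Fin M → Finset (X → Fin K)) (s : State X K M)
    (r : Round X K M) : State X K M where
  L := nextL τ s r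
  B := s.B + Pi.single r.base (bias τ s r)
  rhoInv := nextRhoInv τ s r (bias τ s r)
  S := fun m π =>
    s.S m π +
      if m = r.base ∧ π r.ctx = r.arm then
        (r.loss / s.q τ m) / s.baseProb τ P m r.ctx r.arm
      else 0

/-- The state after a history of rounds, the most recent one first. -/
noncomputable def stateAfter (τ : Tuning M) (P : Fin M → Finset (X → Fin K)) :
    List (Round X K M) → State X K M
  | [] => initState τ
  | r :: h => nextState τ P (stateAfter τ P h) r

end Algorithm

/-- The learner's history before round `t` (rounds are numbered `0, 1, 2, …`). -/
def history {Ω X : Type*} {K M : ℕ} (x : ℕ → Ω → X) (loss : ℕ → Ω → Fin K → ℝ)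
    (base : ℕ → Ω → Fin M) (arm : ℕ → Ω → Fin K) (ω : Ω) : ℕ → List (Round X K M)
  | 0 => []
  | t + 1 =>
    ⟨x t ω, base t ω, arm t ω, loss t ω (arm t ω)⟩ :: history x loss base arm ω t

/-- A `T`-round interaction of Hedged-FTRL, over EXP4 instances on the policy classes `P`, with an
adaptive adversary. The σ-algebra `ℱ t` is all that has happened when the adversary has prepared
the context and the loss vector of round `t` and the learner has not yet acted. The joint law of
the adversary's choices given the past is unrestricted, so contexts and losses may be random and
may depend on everything in the past; only the law of the learner's choices is prescribed. -/
structure Interaction {Ω X : Type*} [mΩ : MeasurableSpace Ω] [MeasurableSpace X] {K M : ℕ}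
    (μ : Measure Ω) (T : ℕ) (τ : Tuning M) (P : Fin M → Finset (X → Fin K)) where
  ℱ : Filtration ℕ mΩ
  x : ℕ → Ω → X
  loss : ℕ → Ω → Fin K → ℝ
  base : ℕ → Ω → Fin M
  arm : ℕ → Ω → Fin K
  x_meas : ∀ t < T, Measurable[ℱ t] (x t)
  loss_meas : ∀ t < T, Measurable[ℱ t] (loss t)
  base_meas : ∀ t < T, Measurable[ℱ (t + 1)] (base t)
  arm_meas : ∀ t < T, Measurable[ℱ (t + 1)] (arm t)
  loss_mem : ∀ t < T, ∀ ω a, loss t ω a ∈ Set.Icc (0 : ℝ) 1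
  law : ∀ t < T, ∀ m a,
    μ[Set.indicator {ω | base t ω = m ∧ arm t ω = a} (fun _ => (1 : ℝ)) | ℱ t] =ᵐ[μ]
      fun ω =>
        let s := stateAfter τ P (history x loss base arm ω t)
        s.q τ m * s.baseProb τ P m (x t ω) a

/-- The pseudo-regret `max_{π ∈ Q} E[∑_t (ℓ_{t, A_t} - ℓ_{t, π(x_t)})]` against a nonempty
finite policy class `Q`. -/
noncomputable def Interaction.regret {Ω X : Type*} [MeasurableSpace Ω] [MeasurableSpace X]
    {K M : ℕ} {μ : Measure Ω} {T : ℕ} {τ : Tuning M} {P : Fin M → Finset (X → Fin K)}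
    (I : Interaction μ T τ P) (Q : Finset (X → Fin K)) (hQ : Q.Nonempty) : ℝ :=
  Q.sup' hQ fun π =>
    ∫ ω, ∑ t ∈ Finset.range T, (I.loss t ω (I.arm t ω) - I.loss t ω (π (I.x t ω))) ∂μ

end HedgedBandit

/-! The variance of the losses fed to instance `m` grows with `ρ`, and so does its regret, like `R m
* √ρ`. The biases are designed to cancel this. Each keeps the accumulated bias, including its
initial value, equal to `R m * √ρ`, so comparing FTRL with coordinate `m` produces a term `-R m *
√ρ` at the final level. This absorbs the entropy term `log |Π_m| / γ` of EXP4 and its second-order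
terms on every path, before any expectation is taken.

The price is that FTRL works with losses reduced by `b`, which costs `q * b` in a round. With `v =
√ρ` moving to `w`, the bias is `R * (w - v)`, and `increase_cost` bounds `q * (w - v)` by `4 * (1/v
- 1/w)` plus a multiple of `η² * √β / q`. The former telescopes to at most `4 * R * √β` per
instance. The latter, averaged over the selected base, contributes `2 * η² * ∑ R * √β` per round.
Together with the Tsallis stability term, whose mean is at most `η * √M`, this is the whole cost of
the top level.

EXP4 is analysed through the normalized log-sum-exp divided by `γ`. It is monotone in `γ`, so the
decreasing learning rates cost nothing extra. `State.Balanced.loss_le_totalPotential` adds both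
potentials along a path; `expected_roundError_le` averages the remaining error over the choice of
base and arm; `Interaction.integral_regret_le` combines the two.

For the tuning put `n = K * T`, `D m = 1 + log |Π_m|`, `η = 1 / √T`, and `R m = 2 * √(n * D m)`.
Capping `β m` at `c² / (M * D m)` makes `∑ R * √β` of order `c * √(M * n)`, while the initial bias
`R m / √(β m)` is of order `max c (D m / c) * √(M * n)`. No logarithmic factor in `T` or `K` arises.
-/

namespace HedgedBandit

/-! ### FTRL with the Tsallis potential: first-order condition, monotonicity, stability. -/

section Ftrl

variable {M : ℕ} {η : ℝ} {G : Fin M → ℝ}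

/-- The objective that the FTRL rule minimizes. -/
noncomputable def ftrlObjective (η : ℝ) (G p : Fin M → ℝ) : ℝ :=
  ∑ i, p i * G i + potential p / η

/-- Intermediate value theorem in `c`. At `min G - M / η` every summand is at most `1 / M²`, so the
sum is at most one; at `min G - 1 / η` the minimal coordinate alone contributes one. -/
lemma exists_ftrl_multiplier [Nonempty (Fin M)] (hη : 0 < η) (G : Fin M → ℝ) :
    ∃ c : ℝ, (∀ i, c < G i) ∧ ∑ i, (1 / (η * (G i - c))) ^ 2 = 1 := by
  obtain ⟨i₀, hi₀⟩ := Finite.exists_min G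
  have hM : (1 : ℝ) ≤ M := by
    have : 0 < M := Fin.pos_iff_nonempty.mpr inferInstance
    exact_mod_cast this
  have hle : G i₀ - M / η ≤ G i₀ - 1 / η := by gcongr
  have hpos : ∀ c ∈ Set.Icc (G i₀ - M / η) (G i₀ - 1 / η), ∀ i, 1 / η ≤ G i - c := by
    intro c hc i
    have := hi₀ i
    have := hc.2
    linarith
  have hη' : 0 < 1 / η := by positivity
  have hcont : ContinuousOn (fun c => ∑ i, (1 / (η * (G i - c))) ^ 2)
      (Set.Icc (G i₀ - M / η) (G i₀ - 1 / η)) := by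
    refine continuousOn_finsetSum _ fun i _ => ContinuousOn.pow ?_ 2
    refine ContinuousOn.div (by fun_prop) (by fun_prop) fun c hc => ?_
    have := hpos c hc i
    have : 0 < G i - c := by linarith
    positivity
  have h1 : ∑ i, (1 / (η * (G i - (G i₀ - M / η)))) ^ 2 ≤ 1 := by
    calc ∑ i, (1 / (η * (G i - (G i₀ - M / η)))) ^ 2 ≤ ∑ _i : Fin M, (1 / (M : ℝ)) ^ 2 := by
          refine Finset.sum_le_sum fun i _ => ?_
          have h1 : (M : ℝ) ≤ η * (G i - (G i₀ - M / η)) := by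
            calc (M : ℝ) = η * (M / η) := by field_simp
              _ ≤ _ := by gcongr; linarith [hi₀ i]
          have h2 : 0 < η * (G i - (G i₀ - M / η)) := by linarith
          gcongr
      _ = 1 / (M : ℝ) := by simp; field_simp
      _ ≤ 1 := by rw [div_le_one (by linarith)]; exact hM
  have h2 : 1 ≤ ∑ i, (1 / (η * (G i - (G i₀ - 1 / η)))) ^ 2 := by
    have := Finset.single_le_sum (f := fun i => (1 / (η * (G i - (G i₀ - 1 / η)))) ^ 2)
      (fun i _ => by positivity) (Finset.mem_univ i₀)
    refine le_trans (le_of_eq ?_) this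
    simp
    field_simp
  obtain ⟨c, hc, hc1⟩ := intermediate_value_Icc hle hcont ⟨h1, h2⟩
  exact ⟨c, fun i => by have := hpos c hc i; linarith, hc1⟩

/-- The right side is the Bregman divergence of `-2 * √·`, divided by `η`. The linear remainder is
`c * (p i - q i)`, which sums to zero because both vectors have total mass one. Being an exact
identity, it yields optimality, uniqueness and the quadratic gain used for stability. -/
lemma ftrlObjective_sub {p q : Fin M → ℝ} {c : ℝ} (hη : 0 < η) (hp : p ∈ stdSimplex ℝ (Fin M))
    (hq1 : ∑ i, q i = 1) (hc : ∀ i, c < G i) (hq : ∀ i, q i = (1 / (η * (G i - c))) ^ 2) :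
    ftrlObjective η G p - ftrlObjective η G q = (∑ i, (√(p i) - √(q i)) ^ 2 / √(q i)) / η := by
  have key : ∀ i, (√(p i) - √(q i)) ^ 2 / √(q i) / η =
      (p i * G i + -2 * √(p i) / η) - (q i * G i + -2 * √(q i) / η) - c * (p i - q i) := by
    intro i
    have h1 : 0 < G i - c := sub_pos.mpr (hc i)
    have h2 : √(q i) = 1 / (η * (G i - c)) := by rw [hq]; exact Real.sqrt_sq (by positivity)
    have h3 : √(p i) ^ 2 = p i := Real.sq_sqrt (hp.1 i)
    have h4 : (√(p i) - √(q i)) ^ 2 / √(q i) / η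
      = (G i - c) * (√(p i) ^ 2 - 2 * √(p i) * (1 / (η * (G i - c))) +
          (1 / (η * (G i - c))) ^ 2) := by
      rw [h2]; field_simp; ring
    rw [h4, h3, h2, hq]
    field_simp
    ring
  rw [Finset.sum_div, Finset.sum_congr rfl fun i _ => key i]
  simp only [Finset.sum_sub_distrib, Finset.sum_add_distrib, ← Finset.mul_sum, hq1, hp.2,
    ftrlObjective, potential, ← Finset.sum_div]
  ring

lemma ftrl_eq_of_multiplier {q : Fin M → ℝ} {c : ℝ} (hη : 0 < η) (hq1 : ∑ i, q i = 1)
    (hc : ∀ i, c < G i) (hq : ∀ i, q i = (1 / (η * (G i - c))) ^ 2) : ftrl η G = q := by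
  have hqs : q ∈ stdSimplex ℝ (Fin M) := ⟨fun i => by rw [hq]; positivity, hq1⟩
  have hmin : IsMinOn (fun p : Fin M → ℝ => ∑ i, p i * G i + potential p / η)
      (stdSimplex ℝ (Fin M)) q := by
    intro p hp
    have h := ftrlObjective_sub hη hp hq1 hc hq
    have h0 : 0 ≤ (∑ i, (√(p i) - √(q i)) ^ 2 / √(q i)) / η := by positivity
    change ftrlObjective η G q ≤ ftrlObjective η G p
    linarith
  obtain ⟨hs, hm⟩ := Classical.epsilon_spec (p := fun q : Fin M → ℝ =>
    q ∈ stdSimplex ℝ (Fin M) ∧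
      IsMinOn (fun p : Fin M → ℝ => ∑ i, p i * G i + potential p / η) (stdSimplex ℝ (Fin M)) q)
    ⟨q, hqs, hmin⟩
  change ftrl η G ∈ _ at hs
  have h := ftrlObjective_sub hη hs hq1 hc hq
  have hle : ftrlObjective η G (ftrl η G) ≤ ftrlObjective η G q := hm hqs
  have hz : ∑ i, (√(ftrl η G i) - √(q i)) ^ 2 / √(q i) = 0 := by
    refine le_antisymm ?_ (by positivity)
    by_contra! hlt
    have := div_pos hlt hη
    linarith
  rw [Finset.sum_eq_zero_iff_of_nonneg (fun i _ => by positivity)] at hz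
  funext i
  have h1 : 0 < G i - c := sub_pos.mpr (hc i)
  have hqi : 0 < √(q i) := by rw [hq]; positivity
  have := hz i (Finset.mem_univ i)
  rw [div_eq_zero_iff, or_iff_left hqi.ne', sq_eq_zero_iff, sub_eq_zero] at this
  exact (Real.sqrt_inj (hs.1 i) (hqs.1 i)).mp this

/-- The first order condition of FTRL: `√qᵢ = 1 / (η (Gᵢ - c))` for some multiplier `c`. -/
lemma ftrl_spec [Nonempty (Fin M)] (hη : 0 < η) (G : Fin M → ℝ) :
    ∃ c : ℝ, (∀ i, c < G i) ∧ (∀ i, ftrl η G i = (1 / (η * (G i - c))) ^ 2) ∧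
      ∑ i, ftrl η G i = 1 := by
  obtain ⟨c, hc, h1⟩ := exists_ftrl_multiplier hη G
  have := ftrl_eq_of_multiplier (q := fun i => (1 / (η * (G i - c))) ^ 2) hη h1 hc fun _ => rfl
  exact ⟨c, hc, fun i => by rw [this], by rw [this]; exact h1⟩

lemma ftrl_pos [Nonempty (Fin M)] (hη : 0 < η) (G : Fin M → ℝ) (i : Fin M) : 0 < ftrl η G i := by
  obtain ⟨c, hc, hq, -⟩ := ftrl_spec hη G
  have : 0 < G i - c := sub_pos.mpr (hc i)
  rw [hq]; positivity

lemma ftrl_sum [Nonempty (Fin M)] (hη : 0 < η) (G : Fin M → ℝ) : ∑ i, ftrl η G i = 1 :=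
  (ftrl_spec hη G).choose_spec.2.2

lemma ftrl_mem_stdSimplex [Nonempty (Fin M)] (hη : 0 < η) (G : Fin M → ℝ) :
    ftrl η G ∈ stdSimplex ℝ (Fin M) :=
  ⟨fun i => (ftrl_pos hη G i).le, ftrl_sum hη G⟩

lemma ftrl_zero [Nonempty (Fin M)] (hη : 0 < η) (i : Fin M) :
    ftrl η (0 : Fin M → ℝ) i = 1 / M := by
  obtain ⟨c, -, hq, h1⟩ := ftrl_spec hη (0 : Fin M → ℝ)
  have hM : (M : ℝ) ≠ 0 := by
    have : 0 < M := Fin.pos_iff_nonempty.mpr inferInstance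
    positivity
  simp only [hq] at h1 ⊢
  simp only [Pi.zero_apply, Finset.sum_const, Finset.card_univ, Fintype.card_fin,
    nsmul_eq_mul] at h1 ⊢
  field_simp at h1 ⊢
  linarith

/-- How the FTRL probabilities react to additional loss `δ ≥ 0` in one coordinate. -/
lemma ftrl_add_single [Nonempty (Fin M)] (hη : 0 < η) (G : Fin M → ℝ) (j : Fin M) {δ : ℝ}
    (hδ : 0 ≤ δ) :
    (∀ i, i ≠ j → ftrl η G i ≤ ftrl η (G + Pi.single j δ) i) ∧
      (√(ftrl η G j))⁻¹ ≤ (√(ftrl η (G + Pi.single j δ) j))⁻¹ ∧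
      (√(ftrl η (G + Pi.single j δ) j))⁻¹ ≤ (√(ftrl η G j))⁻¹ + η * δ := by
  obtain ⟨c, hc, hq, h1⟩ := ftrl_spec hη G
  obtain ⟨c', hc', hq', h1'⟩ := ftrl_spec hη (G + Pi.single j δ)
  have hu : (√(ftrl η G j))⁻¹ = η * (G j - c) := by
    have : 0 < G j - c := sub_pos.mpr (hc j)
    rw [hq, Real.sqrt_sq (by positivity), one_div, inv_inv]
  have hu' : (√(ftrl η (G + Pi.single j δ) j))⁻¹ = η * (G j + δ - c') := by
    have h : 0 < (G + (Pi.single j δ : Fin M → ℝ)) j - c' := sub_pos.mpr (hc' j)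
    rw [hq', Real.sqrt_sq (by positivity), one_div, inv_inv]
    simp
  have hsingle : ∀ i, 0 ≤ (Pi.single j δ : Fin M → ℝ) i ∧ (Pi.single j δ : Fin M → ℝ) i ≤ δ := by
    intro i
    by_cases h : i = j
    · subst h; simp [hδ]
    · simp [h, hδ]
  -- The multiplier moves by an amount in `[0, δ]`. Otherwise all probabilities would strictly
  -- decrease, or all strictly increase, although both vectors sum to one.
  have hcc : c ≤ c' := by
    by_contra! hlt
    have : ∑ i, ftrl η (G + Pi.single j δ) i < ∑ i, ftrl η G i := by
      refine Finset.sum_lt_sum_of_nonempty Finset.univ_nonempty fun i _ => ?_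
      rw [hq, hq']
      have := hsingle i
      have h2 := hc i
      have h3 := hc' i
      simp only [Pi.add_apply] at h3 ⊢
      have h4 : 0 < G i - c := by linarith
      have h5 : G i - c < G i + (Pi.single j δ : Fin M → ℝ) i - c' := by linarith
      gcongr
    linarith
  have hcc' : c' ≤ c + δ := by
    by_contra! hlt
    have : ∑ i, ftrl η G i < ∑ i, ftrl η (G + Pi.single j δ) i := by
      refine Finset.sum_lt_sum_of_nonempty Finset.univ_nonempty fun i _ => ?_
      rw [hq, hq']
      have := hsingle i
      have h2 := hc i
      have h3 := hc' i
      simp only [Pi.add_apply] at h3 ⊢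
      have h4 : 0 < G i + (Pi.single j δ : Fin M → ℝ) i - c' := by linarith
      have h5 : G i + (Pi.single j δ : Fin M → ℝ) i - c' < G i - c := by linarith
      gcongr
    linarith
  refine ⟨fun i hi => ?_, ?_, ?_⟩
  · rw [hq, hq']
    have h3 := hc' i
    simp only [Pi.add_apply, Pi.single_eq_of_ne hi, add_zero] at h3 ⊢
    have h4 : 0 < G i - c' := by linarith
    have h5 : 0 < G i - c := by linarith
    gcongr
  · rw [hu, hu']
    exact mul_le_mul_of_nonneg_left (by linarith) hη.le
  · rw [hu, hu', ← mul_add]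
    exact mul_le_mul_of_nonneg_left (by linarith) hη.le

/-- The value of the FTRL problem. -/
noncomputable def ftrlValue (η : ℝ) (G : Fin M → ℝ) : ℝ := ftrlObjective η G (ftrl η G)

lemma ftrlObjective_ge [Nonempty (Fin M)] (hη : 0 < η) {p : Fin M → ℝ}
    (hp : p ∈ stdSimplex ℝ (Fin M)) :
    ftrlValue η G + (∑ i, (√(p i) - √(ftrl η G i)) ^ 2 / √(ftrl η G i)) / η =
      ftrlObjective η G p := by
  obtain ⟨c, hc, hq, h1⟩ := ftrl_spec hη G
  have := ftrlObjective_sub hη hp h1 hc hq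
  unfold ftrlValue
  linarith

lemma ftrlValue_zero [Nonempty (Fin M)] (hη : 0 < η) :
    ftrlValue η (0 : Fin M → ℝ) = -2 * √M / η := by
  have hM : (0 : ℝ) < M := by
    have : 0 < M := Fin.pos_iff_nonempty.mpr inferInstance
    exact_mod_cast this
  have h : (M : ℝ) * √(1 / M) = √M := by
    rw [Real.sqrt_div zero_le_one, Real.sqrt_one]
    have := Real.sq_sqrt hM.le
    have h0 : √(M : ℝ) ≠ 0 := by positivity
    field_simp
    exact this.symm
  simp only [ftrlValue, ftrlObjective, potential, Pi.zero_apply, mul_zero, Finset.sum_const_zero,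
    zero_add, ftrl_zero hη, Finset.sum_const, Finset.card_univ, Fintype.card_fin, nsmul_eq_mul, h]

lemma ftrlValue_le [Nonempty (Fin M)] (hη : 0 < η) (G : Fin M → ℝ) (m : Fin M) :
    ftrlValue η G ≤ G m := by
  have hp := single_mem_stdSimplex ℝ m
  have h := ftrlObjective_ge (G := G) hη hp
  have h0 : 0 ≤ (∑ i, (√((Pi.single m (1 : ℝ) : Fin M → ℝ) i) - √(ftrl η G i)) ^ 2
    / √(ftrl η G i)) / η := by positivity
  have h1 : ftrlObjective η G (Pi.single m (1 : ℝ)) ≤ G m := by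
    have h2 : potential (Pi.single m (1 : ℝ) : Fin M → ℝ) / η ≤ 0 := by
      refine div_nonpos_of_nonpos_of_nonneg ?_ hη.le
      unfold potential
      have : 0 ≤ ∑ i, √((Pi.single m (1 : ℝ) : Fin M → ℝ) i) := by positivity
      linarith
    have h3 : ∑ i, (Pi.single m (1 : ℝ) : Fin M → ℝ) i * G i = G m := by
      simp [Pi.single_apply]
    unfold ftrlObjective
    linarith
  linarith

/-- The stability of FTRL with the Tsallis potential. -/
lemma le_ftrlValue_add_single [Nonempty (Fin M)] (hη : 0 < η) (G : Fin M → ℝ) (j : Fin M)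
    {δ : ℝ} (hδ : 0 ≤ δ) :
    ftrl η G j * δ - η * √(ftrl η G j) ^ 3 * δ ^ 2 ≤
      ftrlValue η (G + Pi.single j δ) - ftrlValue η G := by
  set q := ftrl η G with hq
  set q' := ftrl η (G + Pi.single j δ) with hq'
  have hs : q' ∈ stdSimplex ℝ (Fin M) := ftrl_mem_stdSimplex hη _
  have h := ftrlObjective_ge (G := G) hη hs
  have h1 : ftrlValue η (G + Pi.single j δ) = ftrlObjective η G q' + q' j * δ := by
    simp only [ftrlValue, ftrlObjective, ← hq', Pi.add_apply, mul_add, Finset.sum_add_distrib]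
    simp [Pi.single_apply]
    ring
  have h2 : (√(q' j) - √(q j)) ^ 2 / √(q j) ≤ ∑ i, (√(q' i) - √(q i)) ^ 2 / √(q i) :=
    Finset.single_le_sum (f := fun i => (√(q' i) - √(q i)) ^ 2 / √(q i))
      (fun i _ => by positivity) (Finset.mem_univ j)
  have h2' := div_le_div_of_nonneg_right h2 hη.le
  have hpos : 0 < q j := ftrl_pos hη G j
  obtain ⟨a, ha, hqa⟩ : ∃ a, 0 < a ∧ q j = a ^ 2 :=
    ⟨√(q j), by positivity, (Real.sq_sqrt hpos.le).symm⟩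
  obtain ⟨b, hb, hqb⟩ : ∃ b, 0 ≤ b ∧ q' j = b ^ 2 :=
    ⟨√(q' j), by positivity, (Real.sq_sqrt (hs.1 j)).symm⟩
  rw [hqa, hqb, Real.sqrt_sq ha.le, Real.sqrt_sq hb] at h2'
  rw [h1, hqa, hqb, Real.sqrt_sq ha.le]
  -- Complete the square after `a² - b² = 2a(a - b) - (a - b)² ≤ 2a(a - b)`.
  have h3 : (a ^ 2 - b ^ 2) * δ - η * a ^ 3 * δ ^ 2 ≤ (b - a) ^ 2 / a / η := by
    have h5 : (b - a) ^ 2 / a / η + η * a ^ 3 * δ ^ 2 - 2 * a * (a - b) * δ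
      = ((a - b) - η * a ^ 2 * δ) ^ 2 / a / η := by field_simp; ring
    have h6 : 0 ≤ ((a - b) - η * a ^ 2 * δ) ^ 2 / a / η := by positivity
    nlinarith [mul_nonneg (sq_nonneg (a - b)) hδ]
  linarith

end Ftrl

/-! ### The bias, the balance invariant and the potential of the top algorithm. -/

section Invariant

variable {X : Type*} {K M : ℕ} {τ : Tuning M} {s : State X K M} {r : Round X K M}

lemma sqrt_inv_min {a b : ℝ} (ha : 0 < a) (hb : 0 < b) :
    √(min a b)⁻¹ = max √a⁻¹ (√b)⁻¹ := by
  rw [← Real.sqrt_inv b]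
  rcases le_total a b with h | h
  · rw [min_eq_left h, max_eq_left]
    gcongr
  · rw [min_eq_right h, max_eq_right]
    gcongr

/-- The invariant that the biases maintain. -/
structure State.Balanced (τ : Tuning M) (s : State X K M) : Prop where
  rhoInv_pos : ∀ j, 0 < s.rhoInv j
  rhoInv_le : ∀ j, s.rhoInv j ≤ τ.β j
  rhoInv_le_q : ∀ j, s.rhoInv j ≤ s.q τ j
  bias_eq : ∀ j, initBias (X := X) (K := K) τ j + s.B j = √(s.rhoInv j)⁻¹ * τ.R j

lemma balanced_initState [Nonempty (Fin M)] (τ : Tuning M) :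
    (initState τ : State X K M).Balanced τ where
  rhoInv_pos j := lt_min (τ.β_pos j) (ftrl_pos τ.η_pos _ j)
  rhoInv_le j := min_le_left _ _
  rhoInv_le_q j := by
    have : (initState τ : State X K M).q τ = ftrl τ.η 0 := by simp [State.q, initState]
    rw [this]
    exact min_le_right _ _
  bias_eq j := by simp [initBias, initState]

/-- FTRL starts from the uniform distribution, and `β ≤ 1 / M`, so the minimum is attained by `β`.
-/
lemma initState_rhoInv [Nonempty (Fin M)] (τ : Tuning M) (j : Fin M) :
    (initState τ : State X K M).rhoInv j = τ.β j := by
  simp only [initState, ftrl_zero τ.η_pos]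
  exact min_eq_left (τ.β_le j)

lemma nextQ_eq (b : ℝ) : nextQ τ s r b =
    ftrl τ.η (s.L - s.B + Pi.single r.base (r.loss / s.q τ r.base - b)) := by
  unfold nextQ nextL
  congr 1
  rw [Pi.single_sub]
  abel

/-- The two bounds of `ftrl_add_single` make the reciprocal root Lipschitz with constant `η`. This
supplies the continuity needed to solve for the bias. -/
lemma continuous_inv_sqrt_ftrl [Nonempty (Fin M)] {η : ℝ} (hη : 0 < η) (G : Fin M → ℝ)
    (j : Fin M) :
    Continuous fun δ : ℝ => (√(ftrl η (G + Pi.single j δ) j))⁻¹ := by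
  refine LipschitzWith.continuous (K := ⟨η, hη.le⟩) (LipschitzWith.of_le_add_mul _ fun a b => ?_)
  have key : ∀ a b : ℝ, a ≤ b → G + Pi.single j b = G + Pi.single j a + Pi.single j (b - a) := by
    intro a b _
    rw [add_assoc, ← Pi.single_add]
    congr 2
    ring
  change _ ≤ _ + η * dist a b
  rcases le_total a b with h | h
  · have := (ftrl_add_single hη (G + Pi.single j a) j (sub_nonneg.mpr h)).2.1
    rw [← key a b h] at this
    have : 0 ≤ η * dist a b := by positivity
    linarith
  · have := (ftrl_add_single hη (G + Pi.single j b) j (sub_nonneg.mpr h)).2.2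
    rw [← key b a h] at this
    rwa [Real.dist_eq, abs_of_nonneg (sub_nonneg.mpr h)]

lemma State.q_pos [Nonempty (Fin M)] (τ : Tuning M) (s : State X K M) (j : Fin M) :
    0 < s.q τ j := ftrl_pos τ.η_pos _ j

lemma State.Balanced.inv_sqrt_q_le (hs : s.Balanced τ) (j : Fin M) :
    (√(s.q τ j))⁻¹ ≤ √(s.rhoInv j)⁻¹ := by
  rw [← Real.sqrt_inv]
  have := hs.rhoInv_pos j
  have := hs.rhoInv_le_q j
  gcongr

/-- Intermediate value theorem on `[0, x]`, with `x` the importance-weighted loss. At `b = 0` the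
bias is at most what is required; at `b = x` FTRL does not move, so no increase of `ρ` has to be
paid for. Since `b ≤ x`, the unselected probabilities do not fall, and their equations persist. -/
lemma State.Balanced.exists_bias [Nonempty (Fin M)] (hs : s.Balanced τ) (h0 : 0 ≤ r.loss) :
    ∃ b : ℝ, 0 ≤ b ∧ ∀ m,
      initBias (X := X) (K := K) τ m + (s.B m + Pi.single (M := fun _ : Fin M => ℝ) r.base b m) =
        √(nextRhoInv τ s r b m)⁻¹ * τ.R m := by
  set j := r.base with hj
  set x := r.loss / s.q τ j with hx
  have hx0 : 0 ≤ x := div_nonneg h0 (s.q_pos τ j).le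
  set v := √(s.rhoInv j)⁻¹ with hv
  have hcont : ContinuousOn (fun b : ℝ => b + v * τ.R j -
      max v (√(ftrl τ.η (s.L - s.B + Pi.single j (x - b)) j))⁻¹ * τ.R j) (Set.Icc 0 x) := by
    have h := continuous_inv_sqrt_ftrl τ.η_pos (s.L - s.B) j
    have h2 : Continuous fun b : ℝ => (√(ftrl τ.η (s.L - s.B + Pi.single j (x - b)) j))⁻¹ :=
      h.comp (continuous_const.sub continuous_id)
    fun_prop
  have h1 : 0 + v * τ.R j -
      max v (√(ftrl τ.η (s.L - s.B + Pi.single j (x - 0)) j))⁻¹ * τ.R j ≤ 0 := by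
    have := mul_le_mul_of_nonneg_right
      (le_max_left v (√(ftrl τ.η (s.L - s.B + Pi.single j (x - 0)) j))⁻¹) (τ.R_nonneg j)
    linarith
  have h2 : 0 ≤ x + v * τ.R j -
      max v (√(ftrl τ.η (s.L - s.B + Pi.single j (x - x)) j))⁻¹ * τ.R j := by
    have : (√(ftrl τ.η (s.L - s.B) j))⁻¹ ≤ v := hs.inv_sqrt_q_le j
    rw [sub_self, Pi.single_zero, add_zero, max_eq_left this]
    linarith
  obtain ⟨b, hb, hb0⟩ := intermediate_value_Icc hx0 hcont ⟨h1, h2⟩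
  refine ⟨b, hb.1, fun m => ?_⟩
  have hδ : 0 ≤ x - b := sub_nonneg.mpr hb.2
  simp only [nextRhoInv, nextQ_eq, ← hj, ← hx]
  have hpos := hs.rhoInv_pos m
  by_cases hm : m = j
  · subst hm
    rw [Pi.single_eq_same, ← add_assoc, hs.bias_eq,
      sqrt_inv_min hpos (ftrl_pos τ.η_pos _ _)]
    simp only at hb0
    linarith
  · rw [Pi.single_eq_of_ne hm, add_zero, hs.bias_eq, min_eq_left]
    exact (hs.rhoInv_le_q m).trans ((ftrl_add_single τ.η_pos _ j hδ).1 m hm)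

/-- The bias is well defined, and at most the importance-weighted loss. -/
lemma State.Balanced.bias_spec [Nonempty (Fin M)] (hs : s.Balanced τ) (h0 : 0 ≤ r.loss) :
    0 ≤ bias τ s r ∧ bias τ s r ≤ r.loss / s.q τ r.base ∧
      ∀ m, initBias (X := X) (K := K) τ m +
        (s.B m + Pi.single (M := fun _ : Fin M => ℝ) r.base (bias τ s r) m) =
          √(nextRhoInv τ s r (bias τ s r) m)⁻¹ * τ.R m := by
  obtain ⟨hb, heq⟩ := Classical.epsilon_spec (hs.exists_bias h0)
  change 0 ≤ bias τ s r at hb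
  change ∀ m, initBias (X := X) (K := K) τ m +
        (s.B m + Pi.single (M := fun _ : Fin M => ℝ) r.base (bias τ s r) m) =
          √(nextRhoInv τ s r (bias τ s r) m)⁻¹ * τ.R m at heq
  refine ⟨hb, ?_, heq⟩
  -- A bias above `x` would not lower the selected probability, so its variance level would stay put
  -- and the balance equation would force the bias to be zero.
  by_contra! hlt
  set j := r.base with hj
  set b := bias τ s r with hbdef
  set x := r.loss / s.q τ j with hx
  have hx0 : 0 ≤ x := div_nonneg h0 (s.q_pos τ j).le
  have h1 := heq j
  have hpos := hs.rhoInv_pos j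
  have h2 := (ftrl_add_single τ.η_pos (s.L - s.B + Pi.single j (x - b)) j
    (sub_nonneg.mpr hlt.le)).2.1
  have h3 : s.L - s.B + Pi.single j (x - b) + Pi.single j (b - x) = s.L - s.B := by
    rw [add_assoc, ← Pi.single_add]
    simp
  rw [h3] at h2
  have h4 := h2.trans (hs.inv_sqrt_q_le j)
  rw [Pi.single_eq_same, ← add_assoc, hs.bias_eq, nextRhoInv, nextQ_eq,
    sqrt_inv_min hpos (ftrl_pos τ.η_pos _ _), max_eq_left h4] at h1
  linarith

variable (P : Fin M → Finset (X → Fin K))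

lemma nextState_rhoInv (τ : Tuning M) (s : State X K M) (r : Round X K M) (j : Fin M) :
    (nextState τ P s r).rhoInv j = min (s.rhoInv j) ((nextState τ P s r).q τ j) := rfl

lemma State.Balanced.next [Nonempty (Fin M)] (hs : s.Balanced τ) (h0 : 0 ≤ r.loss) :
    (nextState τ P s r).Balanced τ where
  rhoInv_pos j := by
    rw [nextState_rhoInv]
    exact lt_min (hs.rhoInv_pos j) (State.q_pos _ _ _)
  rhoInv_le j := (min_le_left _ _).trans (hs.rhoInv_le j)
  rhoInv_le_q j := min_le_right _ _
  bias_eq j := (hs.bias_spec h0).2.2 j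

lemma nextState_sub (τ : Tuning M) (s : State X K M) (r : Round X K M) :
    (nextState τ P s r).L - (nextState τ P s r).B =
      s.L - s.B + Pi.single r.base (r.loss / s.q τ r.base - bias τ s r) := by
  simp only [nextState, nextL]
  rw [Pi.single_sub]
  abel

/-- The variance levels of the bases that are not selected do not change. -/
lemma State.Balanced.rhoInv_of_ne [Nonempty (Fin M)] (hs : s.Balanced τ) (h0 : 0 ≤ r.loss)
    {i : Fin M} (hi : i ≠ r.base) : (nextState τ P s r).rhoInv i = s.rhoInv i := by
  have hb := hs.bias_spec h0
  rw [nextState_rhoInv, State.q, nextState_sub, min_eq_left]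
  exact (hs.rhoInv_le_q i).trans
    ((ftrl_add_single τ.η_pos _ _ (sub_nonneg.mpr hb.2.1)).1 i hi)

/-- The selection probability of the selected base decreases in a controlled way. -/
lemma State.Balanced.inv_sqrt_q_nextState_le [Nonempty (Fin M)] (hs : s.Balanced τ)
    (h0 : 0 ≤ r.loss) (h1 : r.loss ≤ 1) :
    (√((nextState τ P s r).q τ r.base))⁻¹ ≤
      (√(s.q τ r.base))⁻¹ + τ.η * ((√(s.q τ r.base))⁻¹) ^ 2 := by
  have hb := hs.bias_spec h0
  have hq := s.q_pos τ r.base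
  rw [State.q, nextState_sub]
  refine (ftrl_add_single τ.η_pos _ _ (sub_nonneg.mpr hb.2.1)).2.2.trans ?_
  have h2 : r.loss / s.q τ r.base - bias τ s r ≤ ((√(s.q τ r.base))⁻¹) ^ 2 := by
    rw [inv_pow, Real.sq_sqrt hq.le, ← one_div]
    have : r.loss / s.q τ r.base ≤ 1 / s.q τ r.base := by gcongr
    linarith
  have := mul_le_mul_of_nonneg_left h2 τ.η_pos.le
  unfold State.q at *
  linarith

lemma sqrt_nextState_rhoInv [Nonempty (Fin M)] (hs : s.Balanced τ) (j : Fin M) :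
    √((nextState τ P s r).rhoInv j)⁻¹ =
      max √(s.rhoInv j)⁻¹ (√((nextState τ P s r).q τ j))⁻¹ := by
  rw [nextState_rhoInv, sqrt_inv_min (hs.rhoInv_pos j) (State.q_pos _ _ _)]

lemma State.Balanced.sqrt_rhoInv_nextState_le [Nonempty (Fin M)] (hs : s.Balanced τ)
    (h0 : 0 ≤ r.loss) (h1 : r.loss ≤ 1) (j : Fin M) :
    √((nextState τ P s r).rhoInv j)⁻¹ ≤
      √(s.rhoInv j)⁻¹ + τ.η * √(s.rhoInv j)⁻¹ ^ 2 := by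
  have hη := τ.η_pos
  by_cases hj : j = r.base
  · rw [sqrt_nextState_rhoInv P hs]
    refine max_le (le_add_of_nonneg_right (by positivity)) ?_
    have h := hs.inv_sqrt_q_le j
    subst hj
    refine (hs.inv_sqrt_q_nextState_le P h0 h1).trans ?_
    gcongr
  · rw [hs.rhoInv_of_ne P h0 hj]
    exact le_add_of_nonneg_right (by positivity)

/-- The price of one increase of `√ρ`, for `u = 1 / √q`, `v = √ρ`, and `w` the next value of
`√ρ`. -/
lemma increase_cost {η u v w κ : ℝ} (hη : 0 < η) (hu : 0 < u) (huv : u ≤ v) (hκ : 0 < κ)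
    (hκv : κ ≤ v) (hvw : v < w) (hw : w ≤ u + η * u ^ 2) :
    u⁻¹ ^ 2 * (w - v) ≤ 4 * (v⁻¹ - w⁻¹) + 2 * η ^ 2 * κ⁻¹ * u ^ 2 := by
  have hv : 0 < v := hu.trans_le huv
  have hw0 : 0 < w := hv.trans hvw
  have hdiff : v⁻¹ - w⁻¹ = (w - v) / (v * w) := by field_simp
  -- For `η * u < 1`, `w ≤ 2 * u`, hence `v * w ≤ 4 * u²` and the increase is charged to `v⁻¹ -
  -- w⁻¹`. Otherwise one jump costs at most `η`, while `κ ≤ v < w ≤ 2 * η * u²` makes the second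
  -- term at least `η`.
  by_cases h : η * u < 1
  · have h1 : w ≤ 2 * u := by nlinarith
    have h2 : u⁻¹ ^ 2 ≤ 4 / (v * w) := by
      rw [inv_pow, ← one_div, div_le_div_iff₀ (by positivity) (by positivity)]
      nlinarith
    have h3 : u⁻¹ ^ 2 * (w - v) ≤ 4 / (v * w) * (w - v) :=
      mul_le_mul_of_nonneg_right h2 (by linarith)
    have h4 : 0 ≤ 2 * η ^ 2 * κ⁻¹ * u ^ 2 := by positivity
    rw [hdiff]
    have h5 : 4 / (v * w) * (w - v) = 4 * ((w - v) / (v * w)) := by ring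
    linarith
  · push Not at h
    have h1 : κ ≤ 2 * η * u ^ 2 := by nlinarith
    have h2 : u⁻¹ ^ 2 * (w - v) ≤ η := by
      have : u⁻¹ ^ 2 * (w - v) ≤ u⁻¹ ^ 2 * (η * u ^ 2) :=
        mul_le_mul_of_nonneg_left (by linarith) (by positivity)
      refine this.trans (le_of_eq ?_)
      field_simp
    have h3 : η ≤ 2 * η ^ 2 * κ⁻¹ * u ^ 2 := by
      have : 2 * η ^ 2 * κ⁻¹ * u ^ 2 = η * (2 * η * u ^ 2 / κ) := by field_simp
      rw [this]
      have : 1 ≤ 2 * η * u ^ 2 / κ := by rwa [one_le_div hκ]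
      nlinarith
    have h4 : 0 ≤ v⁻¹ - w⁻¹ := by
      rw [hdiff]
      exact div_nonneg (by linarith) (by positivity)
    linarith

/-- The potential of the top algorithm. -/
noncomputable def topPotential (τ : Tuning M) (s : State X K M) : ℝ :=
  ftrlValue τ.η (s.L - s.B) - ∑ i, 4 * τ.R i * √(s.rhoInv i)

/-- FTRL stability converts `q * (x - b)` into a gain of the FTRL value, up to `η / √q` since `0 ≤ x
- b ≤ 1 / q`. As `q * x` is the loss itself, only `q * b` remains. The correction `4 * R * √rhoInv`
in the potential pays the telescoping part of it, and only its selected coordinate changes. -/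
lemma State.Balanced.loss_le [Nonempty (Fin M)] (hs : s.Balanced τ) (h0 : 0 ≤ r.loss)
    (h1 : r.loss ≤ 1) :
    r.loss ≤ topPotential τ (nextState τ P s r) - topPotential τ s +
      (τ.η / √(s.q τ r.base) +
        2 * τ.η ^ 2 * (τ.R r.base * √(τ.β r.base)) / s.q τ r.base) := by
  set s' := nextState τ P s r with hs'def
  have hη := τ.η_pos
  set j := r.base with hj
  have hs' : s'.Balanced τ := hs.next P h0
  obtain ⟨hb0, hbx, hbeq⟩ := hs.bias_spec h0
  have hqp : 0 < s.q τ j := s.q_pos τ j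
  set q := s.q τ j with hq
  set x := r.loss / q with hx
  set b := bias τ s r with hb
  set v := √(s.rhoInv j)⁻¹ with hv
  set w := √(s'.rhoInv j)⁻¹ with hw
  set u := (√q)⁻¹ with hu
  have hsq : 0 < √q := Real.sqrt_pos.mpr hqp
  have hu0 : 0 < u := by positivity
  have huq : u⁻¹ ^ 2 = q := by rw [hu, inv_inv, Real.sq_sqrt hqp.le]
  have huv : u ≤ v := hs.inv_sqrt_q_le j
  have hbR : b = τ.R j * (w - v) := by
    have e1 := hbeq j
    have e2 := hs.bias_eq j
    rw [Pi.single_eq_same] at e1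
    change _ = w * τ.R j at e1
    change _ = v * τ.R j at e2
    linarith
  have hcost : q * (w - v) ≤ 4 * (√(s.rhoInv j) - √(s'.rhoInv j)) +
      2 * τ.η ^ 2 * √(τ.β j) / q := by
    have ev : v⁻¹ = √(s.rhoInv j) := by rw [hv, Real.sqrt_inv, inv_inv]
    have ew : w⁻¹ = √(s'.rhoInv j) := by rw [hw, Real.sqrt_inv, inv_inv]
    have hwm : w = max v (√(s'.q τ j))⁻¹ := sqrt_nextState_rhoInv P hs j
    rcases eq_or_lt_of_le (show v ≤ w from hwm ▸ le_max_left _ _) with h | h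
    · rw [← ev, ← ew, ← h]
      have : 0 ≤ 2 * τ.η ^ 2 * √(τ.β j) / q := by positivity
      simpa using this
    · have hwq : w ≤ u + τ.η * u ^ 2 := by
        rcases max_choice v (√(s'.q τ j))⁻¹ with h2 | h2
        · rw [h2] at hwm; linarith
        · rw [hwm, h2]
          exact hs.inv_sqrt_q_nextState_le P h0 h1
      have hβ := τ.β_pos j
      have := increase_cost (κ := (√(τ.β j))⁻¹) hη hu0 huv (by positivity) ?_ h hwq
      · rw [huq, inv_inv, ev, ew] at this
        have e3 : 2 * τ.η ^ 2 * √(τ.β j) * u ^ 2 = 2 * τ.η ^ 2 * √(τ.β j) / q := by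
          rw [hu, inv_pow, Real.sq_sqrt hqp.le]; ring
        rwa [e3] at this
      · rw [← Real.sqrt_inv, hv]
        have := hs.rhoInv_pos j
        have := hs.rhoInv_le j
        gcongr
  have hqb : q * b ≤ 4 * τ.R j * (√(s.rhoInv j) - √(s'.rhoInv j)) +
      2 * τ.η ^ 2 * (τ.R j * √(τ.β j)) / q := by
    have := mul_le_mul_of_nonneg_left hcost (τ.R_nonneg j)
    rw [hbR]
    have e4 : τ.R j * (4 * (√(s.rhoInv j) - √(s'.rhoInv j)) + 2 * τ.η ^ 2 * √(τ.β j) / q) =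
      4 * τ.R j * (√(s.rhoInv j) - √(s'.rhoInv j)) +
      2 * τ.η ^ 2 * (τ.R j * √(τ.β j)) / q := by ring
    linarith
  have hsum : ∑ i, 4 * τ.R i * √(s.rhoInv i) - ∑ i, 4 * τ.R i * √(s'.rhoInv i) =
      4 * τ.R j * (√(s.rhoInv j) - √(s'.rhoInv j)) := by
    rw [← Finset.sum_sub_distrib, Finset.sum_eq_single j]
    · ring
    · intro i _ hi
      rw [hs.rhoInv_of_ne P h0 hi, sub_self]
    · simp
  have hδ : 0 ≤ x - b := sub_nonneg.mpr hbx
  have hstab := le_ftrlValue_add_single hη (s.L - s.B) j hδ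
  rw [← nextState_sub P τ s r] at hstab
  change q * (x - b) - τ.η * √q ^ 3 * (x - b) ^ 2 ≤ _ at hstab
  have hx1 : x - b ≤ 1 / q := by
    have : x ≤ 1 / q := by rw [hx]; gcongr
    linarith
  have hst2 : τ.η * √q ^ 3 * (x - b) ^ 2 ≤ τ.η / √q := by
    calc τ.η * √q ^ 3 * (x - b) ^ 2 ≤ τ.η * √q ^ 3 * (1 / q) ^ 2 := by gcongr
      _ = τ.η / √q := by
        have h2 := Real.sq_sqrt hqp.le
        have h3 : (1 / q) ^ 2 = 1 / √q ^ 4 := by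
          rw [show √q ^ 4 = (√q ^ 2) ^ 2 by ring, h2]; field_simp
        rw [h3]
        field_simp
  have hqx : q * x = r.loss := by rw [hx]; field_simp
  unfold topPotential
  have : q * (x - b) = r.loss - q * b := by rw [mul_sub, hqx]
  linarith

lemma topPotential_initState_ge [Nonempty (Fin M)] (τ : Tuning M) :
    -(2 * √M / τ.η) - ∑ i, 4 * τ.R i * √(τ.β i) ≤ topPotential τ (initState τ : State X K M) := by
  have h : (initState τ : State X K M).L - (initState τ : State X K M).B = 0 := by
    simp [initState]
  simp only [topPotential, h, ftrlValue_zero τ.η_pos, initState_rhoInv]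
  refine le_of_eq ?_
  ring

/-- Comparing with the vertex `m` gives `L m - B m`, and the balance equation rewrites `B m`. This
is where the negative term `-R m * √ρ` enters. -/
lemma State.Balanced.topPotential_le [Nonempty (Fin M)] (hs : s.Balanced τ) (m : Fin M) :
    topPotential τ s ≤ s.L m - τ.R m * √(s.rhoInv m)⁻¹ + τ.R m / √(τ.β m) := by
  have h1 := ftrlValue_le τ.η_pos (s.L - s.B) m
  have h2 : 0 ≤ ∑ i, 4 * τ.R i * √(s.rhoInv i) :=
    Finset.sum_nonneg fun i _ => by have := τ.R_nonneg i; positivity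
  have h3 := hs.bias_eq m
  have h4 : initBias (X := X) (K := K) τ m = τ.R m / √(τ.β m) := by
    rw [initBias, initState_rhoInv, Real.sqrt_inv]; field_simp
  unfold topPotential
  rw [Pi.sub_apply] at h1
  linarith

end Invariant

/-! ### One-step analysis of exponential weights with a varying learning rate. -/

section Exp4

variable {X : Type*} {K M : ℕ} {P : Finset (X → Fin K)} {γ : ℝ} {S : (X → Fin K) → ℝ}

lemma exp4_normalizer_pos (hP : P.Nonempty) : 0 < ∑ π ∈ P, Real.exp (-γ * S π) :=
  Finset.sum_pos (fun _ _ => Real.exp_pos _) hP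

lemma exp4Prob_nonneg (P : Finset (X → Fin K)) (γ : ℝ) (S : (X → Fin K) → ℝ) (x : X)
    (a : Fin K) : 0 ≤ exp4Prob P γ S x a :=
  div_nonneg (Finset.sum_nonneg fun _ _ => (Real.exp_pos _).le)
    (Finset.sum_nonneg fun _ _ => (Real.exp_pos _).le)

lemma exp4Prob_sum (hP : P.Nonempty) (x : X) : ∑ a, exp4Prob P γ S x a = 1 := by
  simp only [exp4Prob]
  rw [← Finset.sum_div, div_eq_one_iff_eq (exp4_normalizer_pos hP).ne']
  exact Finset.sum_fiberwise P (fun π => π x) fun π => Real.exp (-γ * S π)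

/-- The potential of EXP4. -/
noncomputable def exp4Potential (P : Finset (X → Fin K)) (γ : ℝ) (S : (X → Fin K) → ℝ) : ℝ :=
  Real.log (∑ π ∈ P, 1 / (P.card : ℝ) * Real.exp (-γ * S π)) / γ

lemma exp4_mean_pos (hP : P.Nonempty) :
    0 < ∑ π ∈ P, 1 / (P.card : ℝ) * Real.exp (-γ * S π) := by
  have : (0 : ℝ) < P.card := by exact_mod_cast hP.card_pos
  exact Finset.sum_pos (fun _ _ => mul_pos (by positivity) (Real.exp_pos _)) hP

/-- Power mean inequality with exponent `γ / γ' ≥ 1`. The uniform averaging inside the logarithm is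
essential here. It allows the learning rate to decrease between rounds at no charge. -/
lemma exp4Potential_mono (hP : P.Nonempty) {γ' : ℝ} (hγ' : 0 < γ') (h : γ' ≤ γ) :
    exp4Potential P γ' S ≤ exp4Potential P γ S := by
  have hγ : 0 < γ := hγ'.trans_le h
  have hN : (0 : ℝ) < P.card := by exact_mod_cast hP.card_pos
  have key := Real.rpow_arith_mean_le_arith_mean_rpow P (fun _ => 1 / (P.card : ℝ))
    (fun π => Real.exp (-γ' * S π)) (fun _ _ => by positivity)
    (by simp; field_simp) (fun _ _ => (Real.exp_pos _).le) (p := γ / γ')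
    ((one_le_div hγ').mpr h)
  have e : ∀ π, Real.exp (-γ' * S π) ^ (γ / γ') = Real.exp (-γ * S π) := by
    intro π
    rw [← Real.exp_mul]
    congr 1
    field_simp
  simp only [e] at key
  have hpos := exp4_mean_pos (γ := γ') (S := S) hP
  have h2 := Real.log_le_log (Real.rpow_pos_of_pos hpos _) key
  rw [Real.log_rpow hpos] at h2
  unfold exp4Potential
  rw [div_le_div_iff₀ hγ' hγ]
  have h3 := mul_le_mul_of_nonneg_left h2 hγ'.le
  have e3 : ∀ A : ℝ, γ' * (γ / γ' * A) = A * γ := by intro A; field_simp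
  rw [e3] at h3
  linarith

lemma exp_neg_le_quadratic {x : ℝ} (hx : 0 ≤ x) : Real.exp (-x) ≤ 1 - x + x ^ 2 / 2 := by
  have h := Real.quadratic_le_exp_of_nonneg hx
  rw [Real.exp_neg, inv_le_comm₀ (Real.exp_pos x) (by nlinarith [sq_nonneg (x - 1)])]
  refine le_trans ?_ h
  rw [inv_le_iff_one_le_mul₀ (by nlinarith [sq_nonneg (x - 1)])]
  -- `(1 + x + x²/2) * (1 - x + x²/2) = 1 + x⁴/4`.
  nlinarith [sq_nonneg (x ^ 2)]

/-- The quadratic bound on `exp (-x)` holds for all `x ≥ 0`, so no upper bound on `γ * y` is needed,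
although importance-weighted losses can be arbitrarily large. -/
lemma exp4Potential_update (hP : P.Nonempty) (hγ : 0 < γ) (x : X) (a : Fin K) {y : ℝ}
    (hy : 0 ≤ y) :
    exp4Potential P γ (fun π => S π + if π x = a then y else 0) ≤
      exp4Potential P γ S - exp4Prob P γ S x a * y +
        γ / 2 * (exp4Prob P γ S x a * y ^ 2) := by
  have hN : (0 : ℝ) < P.card := by exact_mod_cast hP.card_pos
  set p := exp4Prob P γ S x a with hp
  set Z := ∑ π ∈ P, Real.exp (-γ * S π) with hZ
  have hZ0 : 0 < Z := exp4_normalizer_pos hP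
  have hp0 : 0 ≤ p := exp4Prob_nonneg _ _ _ _ _
  have hpZ : ∑ π ∈ P, (if π x = a then Real.exp (-γ * S π) else 0) = p * Z := by
    rw [← Finset.sum_filter, hp, exp4Prob, ← hZ]
    field_simp
  have hnew : ∑ π ∈ P, 1 / (P.card : ℝ) * Real.exp (-γ * (S π + if π x = a then y else 0)) =
      (∑ π ∈ P, 1 / (P.card : ℝ) * Real.exp (-γ * S π)) *
        (1 + p * (Real.exp (-(γ * y)) - 1)) := by
    rw [← Finset.mul_sum, ← Finset.mul_sum, mul_assoc, ← hZ]
    congr 1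
    have : ∀ π ∈ P, Real.exp (-γ * (S π + if π x = a then y else 0)) = Real.exp (-γ * S π) +
        (if π x = a then Real.exp (-γ * S π) else 0) * (Real.exp (-(γ * y)) - 1) := by
      intro π _
      split_ifs with h
      · rw [mul_add, Real.exp_add]; ring_nf
      · simp
    rw [Finset.sum_congr rfl this, Finset.sum_add_distrib, ← Finset.sum_mul, hpZ, ← hZ]
    ring
  have hmean := exp4_mean_pos (γ := γ) (S := S) hP
  have hmean' := exp4_mean_pos (γ := γ) (S := fun π => S π + if π x = a then y else 0) hP
  have hfac : 0 < 1 + p * (Real.exp (-(γ * y)) - 1) := by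
    rw [hnew] at hmean'
    exact (pos_iff_pos_of_mul_pos hmean').mp hmean
  have hlog : Real.log (1 + p * (Real.exp (-(γ * y)) - 1)) ≤
      p * (-(γ * y) + (γ * y) ^ 2 / 2) := by
    have h1 := Real.log_le_sub_one_of_pos hfac
    have h2 := mul_le_mul_of_nonneg_left
      (exp_neg_le_quadratic (show 0 ≤ γ * y by positivity)) hp0
    linarith
  unfold exp4Potential
  rw [hnew, Real.log_mul hmean.ne' hfac.ne', add_div]
  have h3 := div_le_div_of_nonneg_right hlog hγ.le
  have e3 : p * (-(γ * y) + (γ * y) ^ 2 / 2) / γ = -(p * y) + γ / 2 * (p * y ^ 2) := by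
    field_simp
  linarith

lemma neg_exp4Potential_le (hγ : 0 < γ) {π : X → Fin K} (hπ : π ∈ P) :
    -exp4Potential P γ S ≤ S π + Real.log P.card / γ := by
  have hN : (0 : ℝ) < P.card := by exact_mod_cast Finset.card_pos.mpr ⟨π, hπ⟩
  have h1 : 1 / (P.card : ℝ) * Real.exp (-γ * S π) ≤
      ∑ π ∈ P, 1 / (P.card : ℝ) * Real.exp (-γ * S π) :=
    Finset.single_le_sum (f := fun π => 1 / (P.card : ℝ) * Real.exp (-γ * S π))
      (fun _ _ => by positivity) hπ
  have h2 := Real.log_le_log (by positivity) h1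
  rw [Real.log_mul (by positivity) (Real.exp_pos _).ne', Real.log_exp, Real.log_div one_ne_zero
    hN.ne', Real.log_one, zero_sub] at h2
  have h3 := div_le_div_of_nonneg_right h2 hγ.le
  unfold exp4Potential
  have e : (-Real.log P.card + -γ * S π) / γ = -(S π + Real.log P.card / γ) := by
    field_simp
    ring
  linarith

lemma exp4Potential_zero (hP : P.Nonempty) (γ : ℝ) :
    exp4Potential P γ (0 : (X → Fin K) → ℝ) = 0 := by
  have hN : (0 : ℝ) < P.card := by exact_mod_cast hP.card_pos
  have : (P.card : ℝ) * (P.card : ℝ)⁻¹ = 1 := by field_simp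
  simp [exp4Potential, this]

end Exp4

/-! ### Potentials of both levels combined along a fixed path. -/

section Pathwise

variable {X : Type*} {K M : ℕ} {τ : Tuning M} {s : State X K M} {r : Round X K M}
  {P : Fin M → Finset (X → Fin K)} {m : Fin M} {π : X → Fin K}

/-- The current learning rate of an EXP4 instance. -/
noncomputable def State.rate (τ : Tuning M) (s : State X K M) (m : Fin M) : ℝ :=
  τ.lr m (s.rhoInv m)⁻¹

/-- The loss estimate that the selected EXP4 instance forms for the arm that was played. -/
noncomputable def lossEstimate (τ : Tuning M) (P : Fin M → Finset (X → Fin K)) (s : State X K M)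
    (r : Round X K M) : ℝ :=
  r.loss / s.q τ r.base / s.baseProb τ P r.base r.ctx r.arm

/-- The part of the regret of one round that the potentials do not account for. -/
noncomputable def roundError (τ : Tuning M) (P : Fin M → Finset (X → Fin K)) (m : Fin M)
    (π : X → Fin K) (s : State X K M) (r : Round X K M) : ℝ :=
  τ.η / √(s.q τ r.base) + 2 * τ.η ^ 2 * (τ.R r.base * √(τ.β r.base)) / s.q τ r.base +
    if r.base = m then
      r.loss / s.q τ r.base - s.baseProb τ P r.base r.ctx r.arm * lossEstimate τ P s r +
        s.rate τ r.base / 2 *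
          (s.baseProb τ P r.base r.ctx r.arm * lossEstimate τ P s r ^ 2) +
        if π r.ctx = r.arm then lossEstimate τ P s r else 0
    else 0

/-- The combined potential of the top algorithm and of the base algorithm `m`. -/
noncomputable def totalPotential (τ : Tuning M) (P : Fin M → Finset (X → Fin K)) (m : Fin M)
    (π : X → Fin K) (s : State X K M) : ℝ :=
  topPotential τ s - exp4Potential (P m) (s.rate τ m) (s.S m) - s.L m - s.S m π

lemma State.Balanced.rate_pos (hs : s.Balanced τ) (m : Fin M) : 0 < s.rate τ m :=
  τ.lr_pos m _ (inv_pos.mpr (hs.rhoInv_pos m))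

/-- If `m` is selected, the EXP4 step is added to the top-level inequality. If not, `L m` and `S m`
are unchanged, and monotonicity of the EXP4 potential in the rate suffices. -/
lemma State.Balanced.loss_le_totalPotential [Nonempty (Fin M)] (hs : s.Balanced τ)
    (hlr : AntitoneOn (τ.lr m) (Set.Ioi 0)) (hP : (P m).Nonempty)
    (h0 : 0 ≤ r.loss) (h1 : r.loss ≤ 1) :
    r.loss ≤ totalPotential τ P m π (nextState τ P s r) - totalPotential τ P m π s +
      roundError τ P m π s r := by
  have htop := hs.loss_le P h0 h1
  have hs' := hs.next P h0
  have hrate : (nextState τ P s r).rate τ m ≤ s.rate τ m := by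
    refine hlr (inv_pos.mpr (hs.rhoInv_pos m)) (inv_pos.mpr (hs'.rhoInv_pos m)) ?_
    have := hs'.rhoInv_pos m
    have : (nextState τ P s r).rhoInv m ≤ s.rhoInv m := min_le_left _ _
    gcongr
  have hmono := exp4Potential_mono (S := (nextState τ P s r).S m) hP
    (hs'.rate_pos m) hrate
  by_cases hm : r.base = m
  · subst hm
    have hc : 0 ≤ lossEstimate τ P s r :=
      div_nonneg (div_nonneg h0 (s.q_pos τ _).le) (exp4Prob_nonneg _ _ _ _ _)
    have hup := exp4Potential_update (S := s.S r.base) hP (hs.rate_pos r.base) r.ctx r.arm hc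
    have hS : (nextState τ P s r).S r.base =
        fun π => s.S r.base π + if π r.ctx = r.arm then lossEstimate τ P s r else 0 := by
      funext π
      simp [nextState, lossEstimate]
    have hL : (nextState τ P s r).L r.base =
        s.L r.base + r.loss / s.q τ r.base := by
      simp [nextState, nextL]
    rw [hS] at hmono
    unfold totalPotential roundError
    rw [if_pos rfl, hS, hL]
    simp only [State.baseProb]
    simp only [State.rate] at *
    linarith
  · have hS : (nextState τ P s r).S m = s.S m := by
      funext π
      simp [nextState, Ne.symm hm]
    have hL : (nextState τ P s r).L m = s.L m := by
      simp [nextState, nextL, Ne.symm hm]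
    rw [hS] at hmono
    unfold totalPotential roundError
    rw [if_neg hm, hS, hL]
    linarith

lemma totalPotential_initState_ge [Nonempty (Fin M)] (hP : (P m).Nonempty) :
    -(2 * √M / τ.η) - ∑ i, 4 * τ.R i * √(τ.β i) ≤
      totalPotential τ P m π (initState τ : State X K M) := by
  have h := topPotential_initState_ge (X := X) (K := K) τ
  have hS : (initState τ : State X K M).S m = 0 := rfl
  have hL : (initState τ : State X K M).L m = 0 := rfl
  rw [totalPotential, hS, exp4Potential_zero hP, hL]
  simpa using h

lemma State.Balanced.totalPotential_le [Nonempty (Fin M)] (hs : s.Balanced τ) (hπ : π ∈ P m) :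
    totalPotential τ P m π s ≤ τ.R m / √(τ.β m) - τ.R m * √(s.rhoInv m)⁻¹ +
      Real.log (P m).card / s.rate τ m := by
  have h1 := hs.topPotential_le m
  have h2 := neg_exp4Potential_le (S := s.S m) (hs.rate_pos m) hπ
  unfold totalPotential
  linarith

/-- Along every path, the states are balanced, and the losses are bounded by potentials. -/
lemma path_balanced [Nonempty (Fin M)] {σ : ℕ → State X K M} {ρ : ℕ → Round X K M} {T : ℕ}
    (h_init : σ 0 = initState τ) (h_next : ∀ t, σ (t + 1) = nextState τ P (σ t) (ρ t))
    (h_loss : ∀ t < T, 0 ≤ (ρ t).loss) {t : ℕ} (ht : t ≤ T) : (σ t).Balanced τ := by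
  induction t with
  | zero => rw [h_init]; exact balanced_initState τ
  | succ t ih => rw [h_next]; exact (ih (by omega)).next P (h_loss t (by omega))

lemma path_loss_le [Nonempty (Fin M)] {σ : ℕ → State X K M} {ρ : ℕ → Round X K M} {T : ℕ}
    (h_init : σ 0 = initState τ) (h_next : ∀ t, σ (t + 1) = nextState τ P (σ t) (ρ t))
    (h_loss : ∀ t < T, (ρ t).loss ∈ Set.Icc (0 : ℝ) 1)
    (hlr : AntitoneOn (τ.lr m) (Set.Ioi 0)) (hπ : π ∈ P m) :
    ∑ t ∈ Finset.range T, (ρ t).loss ≤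
      2 * √M / τ.η + ∑ i, 4 * τ.R i * √(τ.β i) + τ.R m / √(τ.β m) -
        τ.R m * √((σ T).rhoInv m)⁻¹ + Real.log (P m).card / (σ T).rate τ m +
        ∑ t ∈ Finset.range T, roundError τ P m π (σ t) (ρ t) := by
  have hbal : ∀ t ≤ T, (σ t).Balanced τ := fun t ht =>
    path_balanced h_init h_next (fun t ht => (h_loss t ht).1) ht
  have key : ∑ t ∈ Finset.range T, (ρ t).loss ≤
      ∑ t ∈ Finset.range T, ((totalPotential τ P m π (σ (t + 1)) -
        totalPotential τ P m π (σ t)) + roundError τ P m π (σ t) (ρ t)) := by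
    refine Finset.sum_le_sum fun t ht => ?_
    have ht := Finset.mem_range.mp ht
    rw [h_next]
    exact (hbal t ht.le).loss_le_totalPotential hlr ⟨π, hπ⟩ (h_loss t ht).1 (h_loss t ht).2
  rw [Finset.sum_add_distrib, Finset.sum_range_sub fun t => totalPotential τ P m π (σ t)] at key
  have h1 := (hbal T le_rfl).totalPotential_le hπ
  have h2 := totalPotential_initState_ge (τ := τ) (π := π) ⟨π, hπ⟩
  rw [h_init] at key
  linarith

lemma path_rhoInv_antitone {σ : ℕ → State X K M} {ρ : ℕ → Round X K M}
    (h_next : ∀ t, σ (t + 1) = nextState τ P (σ t) (ρ t)) (m : Fin M) :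
    Antitone fun t => (σ t).rhoInv m :=
  antitone_nat_of_succ_le fun t => by rw [h_next]; exact min_le_left _ _

/-- The variance levels are bounded, uniformly over all paths. -/
lemma path_exists_bound [Nonempty (Fin M)] (τ : Tuning M) (P : Fin M → Finset (X → Fin K))
    (j : Fin M) (t : ℕ) :
    ∃ V : ℝ, ∀ (σ : ℕ → State X K M) (ρ : ℕ → Round X K M), σ 0 = initState τ →
      (∀ t, σ (t + 1) = nextState τ P (σ t) (ρ t)) →
      (∀ i < t, (ρ i).loss ∈ Set.Icc (0 : ℝ) 1) → √((σ t).rhoInv j)⁻¹ ≤ V := by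
  induction t with
  | zero => exact ⟨_, fun σ ρ h _ _ => by rw [h]⟩
  | succ t ih =>
    obtain ⟨V, hV⟩ := ih
    refine ⟨V + τ.η * V ^ 2, fun σ ρ h_init h_next h_loss => ?_⟩
    have h := hV σ ρ h_init h_next fun i hi => h_loss i (by omega)
    have hb : (σ t).Balanced τ := path_balanced h_init h_next
      (fun i hi => (h_loss i (Nat.lt_succ_of_lt hi)).1) le_rfl
    have hl := h_loss t (by omega)
    rw [h_next]
    refine (hb.sqrt_rhoInv_nextState_le P hl.1 hl.2 j).trans ?_
    have := τ.η_pos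
    gcongr

end Pathwise

/-! ### Integration against a prescribed conditional law. -/

section CondExp

variable {Ω : Type*} {m m0 : MeasurableSpace Ω} {μ : Measure Ω}

lemma aestronglyMeasurable_comp {f : Ω → ℝ} {φ : ℝ → ℝ} (hφ : Measurable φ)
    (hf : AEStronglyMeasurable[m] f μ) : AEStronglyMeasurable[m] (fun ω => φ (f ω)) μ :=
  ⟨fun ω => φ (hf.mk f ω), (hφ.comp hf.stronglyMeasurable_mk.measurable).stronglyMeasurable,
    hf.ae_eq_mk.fun_comp φ⟩

lemma aestronglyMeasurable_min {f g : Ω → ℝ} (hf : AEStronglyMeasurable[m] f μ)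
    (hg : AEStronglyMeasurable[m] g μ) : AEStronglyMeasurable[m] (fun ω => min (f ω) (g ω)) μ :=
  ⟨fun ω => min (hf.mk f ω) (hg.mk g ω),
    (hf.stronglyMeasurable_mk.measurable.min
      hg.stronglyMeasurable_mk.measurable).stronglyMeasurable, by
      filter_upwards [hf.ae_eq_mk, hg.ae_eq_mk] with ω h1 h2
      rw [h1, h2]⟩

lemma aestronglyMeasurable_sum {ι : Type*} (s : Finset ι) {f : ι → Ω → ℝ}
    (hf : ∀ i, AEStronglyMeasurable[m] (f i) μ) :
    AEStronglyMeasurable[m] (fun ω => ∑ i ∈ s, f i ω) μ := by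
  classical
  induction s using Finset.induction_on with
  | empty => simpa using aestronglyMeasurable_const
  | insert i s hi ih =>
    simp only [Finset.sum_insert hi]
    exact (hf i).add ih

/-- If `g` is the conditional probability of `E`, then for `f` measurable with respect to the
conditioning σ-algebra the integral of `f` over `E` is that of `g * f`. -/
lemma integral_indicator_of_condExp [IsProbabilityMeasure μ] (hm : m ≤ m0) {E : Set Ω}
    (hE : MeasurableSet[m0] E) {g f : Ω → ℝ}
    (hg : μ[E.indicator (fun _ => (1 : ℝ)) | m] =ᵐ[μ] g)
    (hf : AEStronglyMeasurable[m] f μ) (hgf : Integrable (fun ω => g ω * f ω) μ) :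
    Integrable (E.indicator f) μ ∧ ∫ ω, E.indicator f ω ∂μ = ∫ ω, g ω * f ω ∂μ := by
  set h := μ[E.indicator (fun _ => (1 : ℝ)) | m] with hh
  have hh_meas : StronglyMeasurable[m] h := stronglyMeasurable_condExp
  have hind : Integrable (E.indicator (fun _ => (1 : ℝ))) μ :=
    (integrable_const 1).indicator hE
  have hh_int : Integrable h μ := integrable_condExp
  have hh0 : 0 ≤ᵐ[μ] h := condExp_nonneg
    (Filter.Eventually.of_forall fun ω => Set.indicator_nonneg (fun _ _ => zero_le_one) ω)
  set d : Ω → ENNReal := fun ω => ENNReal.ofReal (h ω) with hd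
  have hd_meas : Measurable[m0] d := (hh_meas.measurable.mono hm le_rfl).ennreal_ofReal
  have hd_lt : ∀ᵐ ω ∂μ, d ω < ⊤ := Filter.Eventually.of_forall fun ω => ENNReal.ofReal_lt_top
  -- On the conditioning σ-algebra, `μ` restricted to `E` has density `h`. Passing to these measures
  -- moves `f` across even when `f` is unbounded and its own integrability under `μ` is unknown, as
  -- happens with inverse probabilities.
  have htrim : (μ.restrict E).trim hm = (μ.withDensity d).trim hm := by
    refine @Measure.ext _ m _ _ fun A hA => ?_
    have hA0 := hm A hA
    rw [trim_measurableSet_eq hm hA, trim_measurableSet_eq hm hA,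
      Measure.restrict_apply hA0, withDensity_apply _ hA0]
    rw [← ofReal_integral_eq_lintegral_ofReal hh_int.integrableOn (ae_restrict_of_ae hh0),
      setIntegral_condExp hm hind hA, integral_indicator_const _ hE, smul_eq_mul, mul_one,
      measureReal_def, Measure.restrict_apply hE, Set.inter_comm, ENNReal.ofReal_toReal]
    exact measure_ne_top _ _
  obtain ⟨f', hf', hff'⟩ := hf
  have hf'0 : StronglyMeasurable[m0] f' := hf'.mono hm
  have h1 : (fun ω => g ω * f ω) =ᵐ[μ] fun ω => (d ω).toReal • f' ω := by
    filter_upwards [hg, hff', hh0] with ω e1 e2 e3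
    rw [← e1, e2, hd, ENNReal.toReal_ofReal e3, smul_eq_mul]
  have h2 : E.indicator f =ᵐ[μ] E.indicator f' := by
    filter_upwards [hff'] with ω e
    simp only [Set.indicator, e]
  have hint : Integrable f' (μ.withDensity d) :=
    (integrable_withDensity_iff_integrable_smul' hd_meas hd_lt).mpr (hgf.congr h1)
  have hint' : Integrable f' (μ.restrict E) := by
    refine integrable_of_integrable_trim hm ?_
    rw [htrim]
    exact hint.trim hm hf'
  refine ⟨((integrable_indicator_iff hE).mpr hint').congr h2.symm, ?_⟩
  rw [integral_congr_ae h2, integral_congr_ae h1, integral_indicator hE,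
    integral_trim hm hf', htrim, ← integral_trim hm hf',
    integral_withDensity_eq_integral_toReal_smul hd_meas hd_lt]

end CondExp

/-! ### Averaging the error of one round over base and arm. -/

section RoundError

variable {X : Type*} {K M : ℕ} {τ : Tuning M} {s : State X K M}
  {P : Fin M → Finset (X → Fin K)} {m : Fin M} {π : X → Fin K}

/-- The weight is the probability of the choice, so it cancels the inverse probabilities.
Nonnegativity is kept because the bound also serves to prove integrability. -/
lemma weighted_roundError [Nonempty (Fin M)] (hs : s.Balanced τ) (r : Round X K M)
    (h0 : 0 ≤ r.loss) (h1 : r.loss ≤ 1) :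
    0 ≤ s.q τ r.base * s.baseProb τ P r.base r.ctx r.arm * roundError τ P m π s r ∧
    s.q τ r.base * s.baseProb τ P r.base r.ctx r.arm * roundError τ P m π s r ≤
      s.baseProb τ P r.base r.ctx r.arm *
        (τ.η * √(s.q τ r.base) + 2 * τ.η ^ 2 * (τ.R r.base * √(τ.β r.base))) +
      if r.base = m then
        s.rate τ r.base / 2 / s.q τ r.base + if π r.ctx = r.arm then r.loss else 0
      else 0 := by
  have hη := τ.η_pos
  have hR := τ.R_nonneg r.base
  have hg := hs.rate_pos r.base
  have hq := s.q_pos τ r.base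
  have hp : 0 ≤ s.baseProb τ P r.base r.ctx r.arm := exp4Prob_nonneg _ _ _ _ _
  have hp1 : 0 ≤ s.rate τ r.base / 2 / s.q τ r.base := by positivity
  unfold roundError lossEstimate
  set q := s.q τ r.base
  set p := s.baseProb τ P r.base r.ctx r.arm
  set g := s.rate τ r.base
  set b := τ.R r.base * √(τ.β r.base)
  have hb : 0 ≤ b := by positivity
  have hsq := Real.sq_sqrt hq.le
  have hsq0 : 0 < √q := Real.sqrt_pos.mpr hq
  have e1 : q * p * (τ.η / √q + 2 * τ.η ^ 2 * b / q) =
      p * (τ.η * √q + 2 * τ.η ^ 2 * b) := by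
    have : q * (τ.η / √q) = τ.η * √q := by nth_rewrite 1 [← hsq]; field_simp
    calc q * p * (τ.η / √q + 2 * τ.η ^ 2 * b / q) =
        p * (q * (τ.η / √q) + q * (2 * τ.η ^ 2 * b / q)) := by ring
      _ = _ := by rw [this]; field_simp
  have h2 : 0 ≤ p * (τ.η * √q + 2 * τ.η ^ 2 * b) := by positivity
  rw [mul_add, e1]
  by_cases hm : r.base = m
  · rw [if_pos hm, if_pos hm]
    -- For `p = 0` the division by zero inside the estimate is harmless since the whole term has
    -- weight zero; for `p > 0` the two first-order terms cancel.
    rcases hp.eq_or_lt with hp0 | hp0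
    · rw [← hp0]
      have : 0 ≤ if π r.ctx = r.arm then r.loss else 0 := by split_ifs <;> simp [h0]
      simp only [mul_zero, zero_mul, add_zero, zero_add, le_refl, true_and]
      positivity
    · have e2 : q * p * (r.loss / q - p * (r.loss / q / p) + g / 2 * (p * (r.loss / q / p) ^ 2) +
          if π r.ctx = r.arm then r.loss / q / p else 0) =
          g / 2 / q * r.loss ^ 2 + if π r.ctx = r.arm then r.loss else 0 := by
        split_ifs <;> field_simp <;> ring
      rw [e2]
      have h3 : r.loss ^ 2 ≤ 1 := pow_le_one₀ h0 h1
      have h4 : g / 2 / q * r.loss ^ 2 ≤ g / 2 / q := mul_le_of_le_one_right hp1 h3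
      have h5 : 0 ≤ if π r.ctx = r.arm then r.loss else 0 := by split_ifs <;> simp [h0]
      have h6 : 0 ≤ g / 2 / q * r.loss ^ 2 := by positivity
      constructor <;> linarith
  · rw [if_neg hm, if_neg hm, mul_zero, add_zero]
    exact ⟨h2, le_rfl⟩

lemma sum_sqrt_q_le [Nonempty (Fin M)] (τ : Tuning M) (s : State X K M) :
    ∑ j, √(s.q τ j) ≤ √M := by
  have h := sq_sum_le_card_mul_sum_sq (s := (Finset.univ : Finset (Fin M)))
    (f := fun j => √(s.q τ j))
  simp only [Real.sq_sqrt (s.q_pos τ _).le, Finset.card_univ, Fintype.card_fin] at h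
  have hsum : ∑ j, s.q τ j = 1 := ftrl_sum τ.η_pos _
  rw [hsum, mul_one] at h
  exact Real.le_sqrt_of_sq_le h

/-- The conditional expectation of the error of a round. -/
lemma expected_roundError_le [Nonempty (Fin M)] (hs : s.Balanced τ) (hP : ∀ j, (P j).Nonempty)
    (x : X) {ℓ : Fin K → ℝ} (hℓ : ∀ a, ℓ a ∈ Set.Icc (0 : ℝ) 1) {κ : ℝ}
    (hκ : ∀ ρ, 0 < ρ → K * τ.lr m ρ * √ρ ≤ 2 * κ) :
    ∑ j, ∑ a, s.q τ j * s.baseProb τ P j x a * roundError τ P m π s ⟨x, j, a, ℓ a⟩ ≤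
      τ.η * √M + 2 * τ.η ^ 2 * ∑ j, τ.R j * √(τ.β j) + κ * √(s.rhoInv m)⁻¹ + ℓ (π x) := by
  have hη := τ.η_pos
  calc _ ≤ ∑ j, ∑ a, (s.baseProb τ P j x a *
        (τ.η * √(s.q τ j) + 2 * τ.η ^ 2 * (τ.R j * √(τ.β j))) +
        if j = m then s.rate τ j / 2 / s.q τ j + if π x = a then ℓ a else 0 else 0) :=
        Finset.sum_le_sum fun j _ => Finset.sum_le_sum fun a _ =>
          (weighted_roundError (P := P) (m := m) (π := π) hs ⟨x, j, a, ℓ a⟩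
            (hℓ a).1 (hℓ a).2).2
    _ = τ.η * ∑ j, √(s.q τ j) + 2 * τ.η ^ 2 * ∑ j, τ.R j * √(τ.β j) +
        (K * (s.rate τ m / 2 / s.q τ m) + ℓ (π x)) := by
      have e1 : ∀ j, ∑ a, s.baseProb τ P j x a = 1 := fun j => exp4Prob_sum (hP j) x
      simp only [Finset.sum_add_distrib, ← Finset.sum_mul, e1, one_mul, ← Finset.mul_sum]
      congr 1
      rw [Finset.sum_eq_single m]
      · simp [Finset.sum_add_distrib]
      · intro j _ hj
        simp [hj]
      · simp
    _ ≤ _ := by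
      have h1 := mul_le_mul_of_nonneg_left (sum_sqrt_q_le τ s) hη.le
      -- Here `1 / q ≤ ρ`, and the rate is of order `1 / √ρ`, so the second-order term grows only
      -- like `√ρ`.
      have h2 : K * (s.rate τ m / 2 / s.q τ m) ≤ κ * √(s.rhoInv m)⁻¹ := by
        have hr := hs.rhoInv_pos m
        have hρ : 0 < (s.rhoInv m)⁻¹ := inv_pos.mpr hr
        have h3 := hκ _ hρ
        have h4 : K * (s.rate τ m / 2 / s.q τ m) ≤ K * (s.rate τ m / 2 / s.rhoInv m) := by
          have := hs.rhoInv_le_q m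
          have := hs.rate_pos m
          gcongr
        refine h4.trans ?_
        have h5 := mul_le_mul_of_nonneg_right h3 (Real.sqrt_nonneg (s.rhoInv m)⁻¹)
        rw [mul_assoc, Real.mul_self_sqrt hρ.le] at h5
        change K * s.rate τ m * (s.rhoInv m)⁻¹ ≤ _ at h5
        have e : K * (s.rate τ m / 2 / s.rhoInv m) = K * s.rate τ m * (s.rhoInv m)⁻¹ / 2 := by
          field_simp
        rw [e]
        linarith
      linarith

end RoundError

/-! ### Measurability, integrability and the expected regret. -/

namespace Interaction

variable {Ω X : Type*} [mΩ : MeasurableSpace Ω] [MeasurableSpace X] {K M : ℕ}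
  {μ : Measure Ω} {T : ℕ} {τ : Tuning M} {P : Fin M → Finset (X → Fin K)}
  {m : Fin M} {π : X → Fin K} {t : ℕ}

/-- The state of the learner at the beginning of round `t`. -/
noncomputable def state (I : Interaction μ T τ P) (t : ℕ) (ω : Ω) : State X K M :=
  stateAfter τ P (history I.x I.loss I.base I.arm ω t)

/-- What the learner would record in round `t` if it selected the base `j` and the arm `a`. -/
def roundWith (I : Interaction μ T τ P) (t : ℕ) (ω : Ω) (j : Fin M) (a : Fin K) :
    Round X K M :=
  ⟨I.x t ω, j, a, I.loss t ω a⟩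

variable (I : Interaction μ T τ P)

lemma state_zero (ω : Ω) : I.state 0 ω = initState τ := rfl

lemma state_succ (t : ℕ) (ω : Ω) :
    I.state (t + 1) ω = nextState τ P (I.state t ω) (I.roundWith t ω (I.base t ω) (I.arm t ω)) :=
  rfl

lemma balanced [Nonempty (Fin M)] (ω : Ω) (ht : t ≤ T) : (I.state t ω).Balanced τ :=
  path_balanced (σ := fun t => I.state t ω)
    (ρ := fun t => I.roundWith t ω (I.base t ω) (I.arm t ω)) (I.state_zero ω)
    (fun t => I.state_succ t ω) (fun t ht => (I.loss_mem t ht ω _).1) ht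

/-- The state is built from choice operators, so its measurability is not evident. It is read off
from the prescribed law: the product agrees almost everywhere with a conditional expectation.
Summing over arms then isolates `q`, and dividing isolates the EXP4 probability. -/
lemma aestronglyMeasurable_q_mul_baseProb (ht : t < T) (j : Fin M) (a : Fin K) :
    AEStronglyMeasurable[I.ℱ t]
      (fun ω => (I.state t ω).q τ j * (I.state t ω).baseProb τ P j (I.x t ω) a) μ :=
  ⟨_, stronglyMeasurable_condExp, (I.law t ht j a).symm⟩

lemma aestronglyMeasurable_q (hP : ∀ j, (P j).Nonempty) (ht : t < T) (j : Fin M) :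
    AEStronglyMeasurable[I.ℱ t] (fun ω => (I.state t ω).q τ j) μ := by
  have h := aestronglyMeasurable_sum Finset.univ
    (fun a => I.aestronglyMeasurable_q_mul_baseProb ht j a)
  have e : ∀ ω, ∑ a, (I.state t ω).q τ j * (I.state t ω).baseProb τ P j (I.x t ω) a =
      (I.state t ω).q τ j := by
    intro ω
    rw [← Finset.mul_sum]
    have : ∑ a, (I.state t ω).baseProb τ P j (I.x t ω) a = 1 := exp4Prob_sum (hP j) _
    rw [this, mul_one]
  simpa only [e] using h

lemma aestronglyMeasurable_baseProb [Nonempty (Fin M)] (hP : ∀ j, (P j).Nonempty) (ht : t < T)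
    (j : Fin M) (a : Fin K) :
    AEStronglyMeasurable[I.ℱ t] (fun ω => (I.state t ω).baseProb τ P j (I.x t ω) a) μ := by
  have h := (aestronglyMeasurable_comp measurable_inv (I.aestronglyMeasurable_q hP ht j)).mul
    (I.aestronglyMeasurable_q_mul_baseProb ht j a)
  have e : ∀ ω, ((I.state t ω).q τ j)⁻¹ *
      ((I.state t ω).q τ j * (I.state t ω).baseProb τ P j (I.x t ω) a) =
      (I.state t ω).baseProb τ P j (I.x t ω) a :=
    fun ω => inv_mul_cancel_left₀ ((I.state t ω).q_pos τ j).ne' _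
  refine h.congr (Filter.Eventually.of_forall fun ω => e ω)

lemma aestronglyMeasurable_rhoInv (hP : ∀ j, (P j).Nonempty) (ht : t < T) (j : Fin M) :
    AEStronglyMeasurable[I.ℱ t] (fun ω => (I.state t ω).rhoInv j) μ := by
  induction t with
  | zero => exact aestronglyMeasurable_const
  | succ t ih =>
    exact aestronglyMeasurable_min ((ih (by omega)).mono (I.ℱ.mono t.le_succ))
      (I.aestronglyMeasurable_q hP ht j)

lemma aestronglyMeasurable_sqrt_rho (hP : ∀ j, (P j).Nonempty) (ht : t < T) (j : Fin M) :
    AEStronglyMeasurable[I.ℱ t] (fun ω => √((I.state t ω).rhoInv j)⁻¹) μ :=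
  aestronglyMeasurable_comp (φ := fun z => √z⁻¹) (by fun_prop)
    (I.aestronglyMeasurable_rhoInv hP ht j)

lemma aestronglyMeasurable_rate (hP : ∀ j, (P j).Nonempty) (ht : t < T) (j : Fin M) :
    AEStronglyMeasurable[I.ℱ t] (fun ω => (I.state t ω).rate τ j) μ :=
  aestronglyMeasurable_comp (φ := fun z => τ.lr j z⁻¹) ((τ.lr_meas j).comp measurable_inv)
    (I.aestronglyMeasurable_rhoInv hP ht j)

lemma aestronglyMeasurable_loss (ht : t < T) (a : Fin K) :
    AEStronglyMeasurable[I.ℱ t] (fun ω => I.loss t ω a) μ :=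
  ((measurable_pi_apply a).comp (I.loss_meas t ht)).stronglyMeasurable.aestronglyMeasurable

lemma aestronglyMeasurable_roundError [Nonempty (Fin M)] (hP : ∀ j, (P j).Nonempty) (ht : t < T)
    (hπ : Measurable π) (j : Fin M) (a : Fin K) :
    AEStronglyMeasurable[I.ℱ t]
      (fun ω => roundError τ P m π (I.state t ω) (I.roundWith t ω j a)) μ := by
  have hq := I.aestronglyMeasurable_q hP ht j
  have hp := I.aestronglyMeasurable_baseProb hP ht j a
  have hr := I.aestronglyMeasurable_rate hP ht j
  have hl := I.aestronglyMeasurable_loss ht a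
  have hlq := hl.mul (aestronglyMeasurable_comp measurable_inv hq)
  have hc := hlq.mul (aestronglyMeasurable_comp measurable_inv hp)
  have h1 : AEStronglyMeasurable[I.ℱ t] (fun ω => τ.η / √((I.state t ω).q τ j)) μ :=
    aestronglyMeasurable_comp (φ := fun z => τ.η / √z) (by fun_prop) hq
  have h2 : AEStronglyMeasurable[I.ℱ t]
      (fun ω => 2 * τ.η ^ 2 * (τ.R j * √(τ.β j)) / (I.state t ω).q τ j) μ :=
    aestronglyMeasurable_comp (φ := fun z => 2 * τ.η ^ 2 * (τ.R j * √(τ.β j)) / z)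
      (by fun_prop) hq
  have h3 : AEStronglyMeasurable[I.ℱ t] (fun ω => (I.state t ω).rate τ j / 2) μ :=
    aestronglyMeasurable_comp (φ := fun z => z / 2) (by fun_prop) hr
  have h4 : AEStronglyMeasurable[I.ℱ t] (fun ω => if π (I.x t ω) = a then (1 : ℝ) else 0) μ := by
    have hset : MeasurableSet[I.ℱ t] {ω | π (I.x t ω) = a} :=
      (hπ.comp (I.x_meas t ht)) (measurableSet_singleton a)
    exact (StronglyMeasurable.ite hset stronglyMeasurable_const
      stronglyMeasurable_const).aestronglyMeasurable
  by_cases hj : j = m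
  · refine ((h1.add h2).add (((hlq.sub (hp.mul hc)).add
      (h3.mul (hp.mul (hc.mul hc)))).add (hc.mul h4))).congr
      (Filter.Eventually.of_forall fun ω => ?_)
    simp only [roundError, lossEstimate, roundWith, hj, if_true, Pi.add_apply, Pi.mul_apply,
      Pi.sub_apply, mul_ite, mul_one, mul_zero, div_eq_mul_inv, pow_two]
  · refine (h1.add h2).congr (Filter.Eventually.of_forall fun ω => ?_)
    simp only [roundError, roundWith, hj, if_false, Pi.add_apply, add_zero]

lemma measurableSet_choice (ht : t < T) (j : Fin M) (a : Fin K) :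
    MeasurableSet {ω | I.base t ω = j ∧ I.arm t ω = a} := by
  have h1 := I.ℱ.le (t + 1) _ (I.base_meas t ht (measurableSet_singleton j))
  have h2 := I.ℱ.le (t + 1) _ (I.arm_meas t ht (measurableSet_singleton a))
  exact h1.inter h2

/-- The expectation over the learner's choices in round `t`. -/
lemma integral_choice [IsProbabilityMeasure μ] (ht : t < T) {f : Fin M → Fin K → Ω → ℝ}
    (hf : ∀ j a, AEStronglyMeasurable[I.ℱ t] (f j a) μ)
    (hint : ∀ j a, Integrable (fun ω => (I.state t ω).q τ j *
      (I.state t ω).baseProb τ P j (I.x t ω) a * f j a ω) μ) :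
    Integrable (fun ω => f (I.base t ω) (I.arm t ω) ω) μ ∧
      ∫ ω, f (I.base t ω) (I.arm t ω) ω ∂μ = ∫ ω, ∑ j, ∑ a, (I.state t ω).q τ j *
        (I.state t ω).baseProb τ P j (I.x t ω) a * f j a ω ∂μ := by
  have key := fun j a => integral_indicator_of_condExp (I.ℱ.le t)
    (I.measurableSet_choice ht j a) (I.law t ht j a) (hf j a) (hint j a)
  have e : (fun ω => f (I.base t ω) (I.arm t ω) ω) = fun ω =>
      ∑ j, ∑ a, {ω | I.base t ω = j ∧ I.arm t ω = a}.indicator (f j a) ω := by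
    funext ω
    rw [Finset.sum_eq_single (I.base t ω), Finset.sum_eq_single (I.arm t ω)]
    · simp
    · intro a _ ha
      simp [ha.symm]
    · simp
    · intro j _ hj
      simp [hj.symm]
    · simp
  constructor
  · rw [e]
    exact integrable_finsetSum _ fun j _ => integrable_finsetSum _ fun a _ => (key j a).1
  · rw [e, integral_finsetSum _ fun j _ => integrable_finsetSum _ fun a _ => (key j a).1,
      integral_finsetSum _ fun j _ => integrable_finsetSum _ fun a _ => hint j a]
    refine Finset.sum_congr rfl fun j _ => ?_
    rw [integral_finsetSum _ fun a _ => (key j a).1, integral_finsetSum _ fun a _ => hint j a]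
    exact Finset.sum_congr rfl fun a _ => (key j a).2

lemma exists_sqrt_rho_le [Nonempty (Fin M)] (ht : t ≤ T) (j : Fin M) :
    ∃ V : ℝ, ∀ ω, √((I.state t ω).rhoInv j)⁻¹ ≤ V := by
  obtain ⟨V, hV⟩ := path_exists_bound τ P j t
  exact ⟨V, fun ω => hV (fun t => I.state t ω)
    (fun t => I.roundWith t ω (I.base t ω) (I.arm t ω)) (I.state_zero ω)
    (fun t => I.state_succ t ω) fun i hi => I.loss_mem i (by omega) ω _⟩

lemma integrable_sqrt_rho [IsProbabilityMeasure μ] [Nonempty (Fin M)]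
    (hP : ∀ j, (P j).Nonempty) (ht : t < T) (j : Fin M) :
    Integrable (fun ω => √((I.state t ω).rhoInv j)⁻¹) μ := by
  obtain ⟨V, hV⟩ := I.exists_sqrt_rho_le ht.le j
  refine Integrable.of_bound ((I.aestronglyMeasurable_sqrt_rho hP ht j).mono (I.ℱ.le t)) V
    (Filter.Eventually.of_forall fun ω => ?_)
  rw [Real.norm_of_nonneg (Real.sqrt_nonneg _)]
  exact hV ω

lemma integrable_loss_comp [IsProbabilityMeasure μ] (ht : t < T) {A : Ω → Fin K}
    (hA : Measurable A) : Integrable (fun ω => I.loss t ω (A ω)) μ := by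
  have h1 : Measurable fun p : (Fin K → ℝ) × Fin K => p.1 p.2 :=
    measurable_from_prod_countable_left fun a => measurable_pi_apply a
  have h2 : Measurable fun ω => I.loss t ω (A ω) :=
    h1.comp (((I.loss_meas t ht).mono (I.ℱ.le t) le_rfl).prodMk hA)
  refine Integrable.of_bound h2.aestronglyMeasurable 1 (Filter.Eventually.of_forall fun ω => ?_)
  have := I.loss_mem t ht ω (A ω)
  rw [Real.norm_of_nonneg this.1]
  exact this.2

lemma integral_roundError_le [IsProbabilityMeasure μ] [Nonempty (Fin M)]
    (hP : ∀ j, (P j).Nonempty) (hπ : Measurable π) (ht : t < T)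
    (hlr : AntitoneOn (τ.lr m) (Set.Ioi 0)) {κ : ℝ}
    (hκ : ∀ ρ, 0 < ρ → K * τ.lr m ρ * √ρ ≤ 2 * κ) :
    Integrable (fun ω => roundError τ P m π (I.state t ω)
      (I.roundWith t ω (I.base t ω) (I.arm t ω))) μ ∧
    ∫ ω, roundError τ P m π (I.state t ω)
      (I.roundWith t ω (I.base t ω) (I.arm t ω)) ∂μ ≤
        τ.η * √M + 2 * τ.η ^ 2 * ∑ j, τ.R j * √(τ.β j) +
          ∫ ω, κ * √((I.state t ω).rhoInv m)⁻¹ ∂μ + ∫ ω, I.loss t ω (π (I.x t ω)) ∂μ := by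
  obtain ⟨V, hV⟩ := I.exists_sqrt_rho_le ht.le m
  have hη := τ.η_pos
  have hmeas := fun j a => I.aestronglyMeasurable_roundError (m := m) hP ht hπ j a
  have hint : ∀ j a, Integrable (fun ω => (I.state t ω).q τ j *
      (I.state t ω).baseProb τ P j (I.x t ω) a *
        roundError τ P m π (I.state t ω) (I.roundWith t ω j a)) μ := by
    intro j a
    refine Integrable.of_bound (((I.aestronglyMeasurable_q_mul_baseProb ht j a).mul
      (hmeas j a)).mono (I.ℱ.le t))
      -- The deterministic bound `V` on `√ρ` gives `1 / q ≤ V²`, and the rate never exceeds its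
      -- initial value at `1 / β`.
      ((τ.η + 2 * τ.η ^ 2 * (τ.R j * √(τ.β j))) + (τ.lr m (τ.β m)⁻¹ / 2 * V ^ 2 + 1))
      (Filter.Eventually.of_forall fun ω => ?_)
    have hs := I.balanced ω ht.le
    have hl := I.loss_mem t ht ω a
    have hw := weighted_roundError (P := P) (m := m) (π := π) hs (I.roundWith t ω j a) hl.1 hl.2
    have hw1 : (I.state t ω).q τ j * (I.state t ω).baseProb τ P j (I.x t ω) a *
        roundError τ P m π (I.state t ω) (I.roundWith t ω j a) ≤
        (I.state t ω).baseProb τ P j (I.x t ω) a *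
          (τ.η * √((I.state t ω).q τ j) + 2 * τ.η ^ 2 * (τ.R j * √(τ.β j))) +
        if j = m then (I.state t ω).rate τ j / 2 / (I.state t ω).q τ j +
          if π (I.x t ω) = a then I.loss t ω a else 0 else 0 := hw.2
    refine (Real.norm_of_nonneg hw.1).le.trans ?_
    refine hw1.trans (add_le_add ?_ ?_)
    · have hp1 : (I.state t ω).baseProb τ P j (I.x t ω) a ≤ 1 := by
        rw [← exp4Prob_sum (γ := (I.state t ω).rate τ j) (S := (I.state t ω).S j) (hP j) (I.x t ω)]
        exact Finset.single_le_sum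
          (f := fun a => exp4Prob (P j) ((I.state t ω).rate τ j) ((I.state t ω).S j) (I.x t ω) a)
          (fun _ _ => exp4Prob_nonneg _ _ _ _ _) (Finset.mem_univ a)
      have hq1 : √((I.state t ω).q τ j) ≤ 1 := by
        rw [Real.sqrt_le_one]
        have hsum : ∑ j, (I.state t ω).q τ j = 1 := ftrl_sum τ.η_pos _
        rw [← hsum]
        exact Finset.single_le_sum (f := fun j => (I.state t ω).q τ j)
          (fun _ _ => (State.q_pos _ _ _).le) (Finset.mem_univ j)
      have hR := τ.R_nonneg j
      refine (mul_le_of_le_one_left (by positivity) hp1).trans ?_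
      gcongr
      exact mul_le_of_le_one_right hη.le hq1
    · have hr := hs.rate_pos m
      have hr' : (I.state t ω).rate τ m ≤ τ.lr m (τ.β m)⁻¹ :=
        hlr (inv_pos.mpr (τ.β_pos m)) (inv_pos.mpr (hs.rhoInv_pos m))
          (inv_anti₀ (hs.rhoInv_pos m) (hs.rhoInv_le m))
      have hβ := τ.lr_pos m _ (inv_pos.mpr (τ.β_pos m))
      by_cases hj : j = m
      · subst hj
        rw [if_pos rfl]
        refine add_le_add ?_ (by split_ifs; exacts [hl.2, zero_le_one])
        rw [div_eq_mul_inv]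
        have hq2 : ((I.state t ω).q τ j)⁻¹ ≤ V ^ 2 := by
          have h3 := (hs.inv_sqrt_q_le j).trans (hV ω)
          have h4 := (State.q_pos τ (I.state t ω) j).le
          calc ((I.state t ω).q τ j)⁻¹ = ((√((I.state t ω).q τ j))⁻¹) ^ 2 := by
                rw [inv_pow, Real.sq_sqrt h4]
            _ ≤ V ^ 2 := by gcongr
        have := inv_nonneg.mpr (State.q_pos τ (I.state t ω) j).le
        gcongr
      · rw [if_neg hj]
        positivity
  obtain ⟨h1, h2⟩ := I.integral_choice ht
    (f := fun j a ω => roundError τ P m π (I.state t ω) (I.roundWith t ω j a)) hmeas hint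
  refine ⟨h1, ?_⟩
  rw [h2]
  have hi1 : Integrable (fun ω => κ * √((I.state t ω).rhoInv m)⁻¹) μ :=
    (I.integrable_sqrt_rho hP ht m).const_mul κ
  have hi2 : Integrable (fun ω => I.loss t ω (π (I.x t ω))) μ :=
    I.integrable_loss_comp ht (hπ.comp ((I.x_meas t ht).mono (I.ℱ.le t) le_rfl))
  set c := τ.η * √M + 2 * τ.η ^ 2 * ∑ j, τ.R j * √(τ.β j) with hc
  have hi3 : Integrable (fun ω => c + κ * √((I.state t ω).rhoInv m)⁻¹) μ :=
    (integrable_const c).add hi1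
  calc _ ≤ ∫ ω, (c + κ * √((I.state t ω).rhoInv m)⁻¹ + I.loss t ω (π (I.x t ω))) ∂μ :=
        integral_mono (integrable_finsetSum _ fun j _ => integrable_finsetSum _ fun a _ =>
          hint j a) (hi3.add hi2) fun ω =>
          expected_roundError_le (I.balanced ω ht.le) hP (I.x t ω) (I.loss_mem t ht ω) hκ
    _ = _ := by
      rw [integral_add hi3 hi2, integral_add (integrable_const c) hi1]
      simp

/-- The regret of Hedged-FTRL with general tuning parameters. -/
theorem integral_regret_le [IsProbabilityMeasure μ] (hP : ∀ j, (P j).Nonempty)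
    (hπP : π ∈ P m) (hπ : Measurable π) (hlr : AntitoneOn (τ.lr m) (Set.Ioi 0)) {κ : ℝ}
    (hκ0 : 0 ≤ κ) (hκ : ∀ ρ, 0 < ρ → K * τ.lr m ρ * √ρ ≤ 2 * κ)
    (hR : ∀ ρ, 0 < ρ → Real.log (P m).card / τ.lr m ρ + T * κ * √ρ ≤ τ.R m * √ρ) :
    ∫ ω, ∑ t ∈ Finset.range T, (I.loss t ω (I.arm t ω) - I.loss t ω (π (I.x t ω))) ∂μ ≤
      2 * √M / τ.η + ∑ i, 4 * τ.R i * √(τ.β i) + τ.R m / √(τ.β m) +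
        T * (τ.η * √M + 2 * τ.η ^ 2 * ∑ j, τ.R j * √(τ.β j)) := by
  have : Nonempty (Fin M) := ⟨m⟩
  set c := 2 * √M / τ.η + ∑ i, 4 * τ.R i * √(τ.β i) + τ.R m / √(τ.β m) with hc
  set err : ℕ → Ω → ℝ := fun t ω => roundError τ P m π (I.state t ω)
      (I.roundWith t ω (I.base t ω) (I.arm t ω)) with herr
  -- The final `√ρ` is random, so `hR` is applied on each path: it cancels the entropy term and `T *
  -- κ * √ρ` against `R m * √ρ`. The terms `κ * √ρ` of the single rounds, dominated by the final
  -- one, are subtracted here and return in the expected errors.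
  have hpath : ∀ ω, ∑ t ∈ Finset.range T, (I.loss t ω (I.arm t ω) - I.loss t ω (π (I.x t ω))) ≤
      c + ∑ t ∈ Finset.range T,
        (err t ω - κ * √((I.state t ω).rhoInv m)⁻¹ - I.loss t ω (π (I.x t ω))) := by
    intro ω
    have h := path_loss_le (σ := fun t => I.state t ω)
      (ρ := fun t => I.roundWith t ω (I.base t ω) (I.arm t ω)) (I.state_zero ω)
      (fun t => I.state_succ t ω) (fun t ht => I.loss_mem t ht ω _) hlr hπP
    have hbT := I.balanced ω le_rfl
    have h1 := hR _ (inv_pos.mpr (hbT.rhoInv_pos m))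
    have h2 : ∑ t ∈ Finset.range T, κ * √((I.state t ω).rhoInv m)⁻¹ ≤
        T * κ * √((I.state T ω).rhoInv m)⁻¹ := by
      have : ∀ t ∈ Finset.range T, κ * √((I.state t ω).rhoInv m)⁻¹ ≤
          κ * √((I.state T ω).rhoInv m)⁻¹ := by
        intro t ht
        have ht := (Finset.mem_range.mp ht).le
        have h3 := path_rhoInv_antitone (σ := fun t => I.state t ω)
          (fun t => I.state_succ t ω) m ht
        have h4 := hbT.rhoInv_pos m
        simp only at h3
        gcongr
      refine (Finset.sum_le_card_nsmul _ _ _ this).trans (le_of_eq ?_)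
      simp [mul_assoc]
    simp only [Finset.sum_sub_distrib]
    change ∑ t ∈ Finset.range T, I.loss t ω (I.arm t ω) ≤ c - _ +
      Real.log (P m).card / τ.lr m ((I.state T ω).rhoInv m)⁻¹ +
        ∑ t ∈ Finset.range T, err t ω at h
    linarith
  have hi1 : ∀ t ∈ Finset.range T, Integrable (fun ω => κ * √((I.state t ω).rhoInv m)⁻¹) μ :=
    fun t ht => (I.integrable_sqrt_rho hP (Finset.mem_range.mp ht) m).const_mul κ
  have hi2 : ∀ t ∈ Finset.range T, Integrable (fun ω => I.loss t ω (π (I.x t ω))) μ :=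
    fun t ht => I.integrable_loss_comp (Finset.mem_range.mp ht)
      (hπ.comp ((I.x_meas t (Finset.mem_range.mp ht)).mono (I.ℱ.le t) le_rfl))
  have hi3 : ∀ t ∈ Finset.range T, Integrable (fun ω => I.loss t ω (I.arm t ω)) μ :=
    fun t ht => I.integrable_loss_comp (Finset.mem_range.mp ht)
      ((I.arm_meas t (Finset.mem_range.mp ht)).mono (I.ℱ.le (t + 1)) le_rfl)
  have hi4 := fun t (ht : t ∈ Finset.range T) =>
    I.integral_roundError_le (m := m) hP hπ (Finset.mem_range.mp ht) hlr hκ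
  have hi5 : ∀ t ∈ Finset.range T, Integrable (fun ω =>
      err t ω - κ * √((I.state t ω).rhoInv m)⁻¹ - I.loss t ω (π (I.x t ω))) μ :=
    fun t ht => ((hi4 t ht).1.sub (hi1 t ht)).sub (hi2 t ht)
  calc _ ≤ ∫ ω, (c + ∑ t ∈ Finset.range T,
        (err t ω - κ * √((I.state t ω).rhoInv m)⁻¹ - I.loss t ω (π (I.x t ω)))) ∂μ :=
        integral_mono (integrable_finsetSum _ fun t ht => (hi3 t ht).sub (hi2 t ht))
          ((integrable_const c).add (integrable_finsetSum _ hi5)) hpath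
    _ = c + ∑ t ∈ Finset.range T, ∫ ω,
        (err t ω - κ * √((I.state t ω).rhoInv m)⁻¹ - I.loss t ω (π (I.x t ω))) ∂μ := by
      rw [integral_add (integrable_const c) (integrable_finsetSum _ hi5),
        integral_finsetSum _ hi5]
      simp
    _ ≤ c + ∑ _t ∈ Finset.range T,
        (τ.η * √M + 2 * τ.η ^ 2 * ∑ j, τ.R j * √(τ.β j)) := by
      gcongr with t ht
      have hi6 : Integrable (fun ω => err t ω - κ * √((I.state t ω).rhoInv m)⁻¹) μ :=
        (hi4 t ht).1.sub (hi1 t ht)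
      rw [integral_sub hi6 (hi2 t ht), integral_sub (hi4 t ht).1 (hi1 t ht)]
      have := (hi4 t ht).2
      linarith
    _ = _ := by simp [mul_add]

end Interaction

/-! ### Choice of the parameters and the resulting constants. -/

section Tuning

variable {M : ℕ}

/-- The tuning for a horizon `T`, with `n = K T` and complexities `D m` of the policy classes. -/
noncomputable def paretoTuning (T n c : ℝ) (D : Fin M → ℝ) (hT : 0 < T) (hn : 0 < n)
    (hc : 0 < c) (hD : ∀ m, 0 < D m) : Tuning M where
  η := 1 / √T
  R m := 2 * √(n * D m)
  β m := min (1 / (M : ℝ)) (c ^ 2 / (M * D m))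
  lr m ρ := √(D m / n) / √ρ
  η_pos := by positivity
  R_nonneg m := by positivity
  β_pos m := by
    have hM : (0 : ℝ) < M := by exact_mod_cast m.pos
    have := hD m
    exact lt_min (by positivity) (by positivity)
  β_le m := min_le_left _ _
  lr_pos m ρ hρ := by
    have := hD m
    positivity
  lr_meas m := by fun_prop

/-- A tuning for degenerate horizons. -/
noncomputable def trivialTuning (M : ℕ) : Tuning M where
  η := 1
  R _ := 0
  β _ := 1 / (M : ℝ)
  lr _ _ := 1
  η_pos := one_pos
  R_nonneg _ := le_rfl
  β_pos m := by
    have hM : (0 : ℝ) < M := by exact_mod_cast m.pos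
    positivity
  β_le _ := le_rfl
  lr_pos _ _ _ := one_pos
  lr_meas _ := measurable_const

/-- The cap `c² / (M * D j)` on `β j` removes the dependence on `D j`, so every instance contributes
at most `2 * c * √(n / M)`. -/
lemma sum_R_mul_sqrt_β_le {T n c : ℝ} {D : Fin M → ℝ} (hT : 0 < T) (hn : 0 < n)
    (hc : 0 < c) (hD : ∀ m, 0 < D m) :
    ∑ j, (paretoTuning T n c D hT hn hc hD).R j * √((paretoTuning T n c D hT hn hc hD).β j) ≤
      2 * c * √(M * n) := by
  have h : ∀ j ∈ Finset.univ, (paretoTuning T n c D hT hn hc hD).R j *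
      √((paretoTuning T n c D hT hn hc hD).β j) ≤ 2 * c * √(n / M) := by
    intro j _
    have hM : (0 : ℝ) < M := by exact_mod_cast j.pos
    have hDj := hD j
    change 2 * √(n * D j) * √(min (1 / (M : ℝ)) (c ^ 2 / (M * D j))) ≤ _
    calc 2 * √(n * D j) * √(min (1 / (M : ℝ)) (c ^ 2 / (M * D j)))
        ≤ 2 * √(n * D j) * √(c ^ 2 / (M * D j)) := by
          gcongr
          exact min_le_right _ _
      _ = 2 * √(c ^ 2 * (n / M)) := by
          rw [mul_assoc, ← Real.sqrt_mul (by positivity)]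
          congr 2
          field_simp
      _ = 2 * c * √(n / M) := by
          rw [Real.sqrt_mul (by positivity), Real.sqrt_sq hc.le, mul_assoc]
  refine (Finset.sum_le_card_nsmul _ _ _ h).trans (le_of_eq ?_)
  rcases Nat.eq_zero_or_pos M with h0 | h0
  · subst h0; simp
  · have hM : (0 : ℝ) < M := by exact_mod_cast h0
    have e : (M : ℝ) * √(n / M) = √(M * n) := by
      have h1 : (M : ℝ) * n = M ^ 2 * (n / M) := by field_simp
      rw [h1, Real.sqrt_mul (by positivity), Real.sqrt_sq hM.le]
    simp only [Finset.card_univ, Fintype.card_fin, nsmul_eq_mul]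
    rw [← e]
    ring

/-- When `β = 1 / M` the claim reduces to `D = c * (D / c) ≤ (max c (D / c))²`; when the cap is
active the left side is exactly `2 * (D / c) * √(M * n)`. -/
lemma R_div_sqrt_β_le {T n c : ℝ} {D : Fin M → ℝ} (hT : 0 < T) (hn : 0 < n)
    (hc : 0 < c) (hD : ∀ m, 0 < D m) (m : Fin M) :
    (paretoTuning T n c D hT hn hc hD).R m / √((paretoTuning T n c D hT hn hc hD).β m) ≤
      2 * max c (D m / c) * √(M * n) := by
  have hM : (0 : ℝ) < M := by exact_mod_cast m.pos
  have hDm := hD m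
  have hmax : 0 < max c (D m / c) := lt_max_of_lt_left hc
  change 2 * √(n * D m) / √(min (1 / (M : ℝ)) (c ^ 2 / (M * D m))) ≤ _
  have hβ : n * D m ≤ max c (D m / c) ^ 2 * (M * n) * min (1 / (M : ℝ)) (c ^ 2 / (M * D m)) := by
    have h1 : D m ≤ max c (D m / c) ^ 2 := by
      calc D m = c * (D m / c) := by field_simp
        _ ≤ max c (D m / c) * max c (D m / c) := by
          gcongr
          exacts [le_max_left _ _, le_max_right _ _]
        _ = _ := by ring
    have h2 : (D m / c) ^ 2 ≤ max c (D m / c) ^ 2 := by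
      gcongr
      exact le_max_right _ _
    rcases min_choice (1 / (M : ℝ)) (c ^ 2 / (M * D m)) with h | h <;> rw [h]
    · calc n * D m ≤ n * max c (D m / c) ^ 2 := by gcongr
        _ = _ := by field_simp
    · calc n * D m = (D m / c) ^ 2 * (M * n) * (c ^ 2 / (M * D m)) := by field_simp
        _ ≤ _ := by gcongr
  have hβ0 : 0 < min (1 / (M : ℝ)) (c ^ 2 / (M * D m)) := lt_min (by positivity) (by positivity)
  rw [div_le_iff₀ (Real.sqrt_pos.mpr hβ0)]
  have h3 := Real.sqrt_le_sqrt hβ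
  rw [Real.sqrt_mul (x := max c (D m / c) ^ 2 * (M * n)) (by positivity),
    Real.sqrt_mul (x := max c (D m / c) ^ 2) (by positivity), Real.sqrt_sq hmax.le] at h3
  linarith

end Tuning

theorem Interaction.integral_regret_paretoTuning_le {Ω X : Type*} [MeasurableSpace Ω]
    [MeasurableSpace X] {K M T : ℕ} {μ : Measure Ω} [IsProbabilityMeasure μ]
    {P : Fin M → Finset (X → Fin K)} (hP : ∀ j, (P j).Nonempty) {c n : ℝ} (hT : (0 : ℝ) < T)
    (hn_eq : n = K * T) (hn : 0 < n) (hc : 0 < c) {D : Fin M → ℝ} (hD : ∀ m, 0 < D m)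
    {τ : Tuning M} (hτ : τ = paretoTuning T n c D hT hn hc hD) (I : Interaction μ T τ P) {m : Fin M}
    (hDm : Real.log (P m).card ≤ D m) {π : X → Fin K} (hπP : π ∈ P m) (hπ : Measurable π) :
    ∫ ω, ∑ t ∈ Finset.range T, (I.loss t ω (I.arm t ω) - I.loss t ω (π (I.x t ω))) ∂μ ≤
      (3 + 12 * c + 2 * max c (D m / c)) * √(M * n) := by
  have hDm0 := hD m
  have hK : (0 : ℝ) < K := pos_of_mul_pos_left (hn_eq ▸ hn) hT.le
  have hηT : √(T : ℝ) ^ 2 = T := Real.sq_sqrt hT.le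
  have hsT : 0 < √(T : ℝ) := Real.sqrt_pos.mpr hT
  have e_n : √(n * D m) = n * √(D m / n) := by
    have : n * D m = n ^ 2 * (D m / n) := by field_simp
    rw [this, Real.sqrt_mul (by positivity), Real.sqrt_sq hn.le]
  have h := I.integral_regret_le hP hπP hπ (κ := K * √(D m / n) / 2)
    (by
      intro ρ hρ ρ' _ hle
      have : (0 : ℝ) < ρ := hρ
      subst hτ
      change √(D m / n) / √ρ' ≤ √(D m / n) / √ρ
      gcongr)
    (by positivity)
    (by
      intro ρ hρ
      subst hτ
      change K * (√(D m / n) / √ρ) * √ρ ≤ _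
      have : 0 < √ρ := Real.sqrt_pos.mpr hρ
      refine le_of_eq ?_
      field_simp)
    -- The entropy term is at most `√(n * D) * √ρ` and the accumulated second-order term is half of
    -- that, which fits under the factor `2` in `R`.
    (by
      intro ρ hρ
      subst hτ
      change Real.log (P m).card / (√(D m / n) / √ρ) + _ ≤ 2 * √(n * D m) * √ρ
      have hρ0 : 0 < √ρ := Real.sqrt_pos.mpr hρ
      have hdn : 0 < √(D m / n) := by positivity
      have h1 : Real.log (P m).card / (√(D m / n) / √ρ) ≤ n * √(D m / n) * √ρ := by
        calc Real.log (P m).card / (√(D m / n) / √ρ) ≤ D m / (√(D m / n) / √ρ) := by gcongr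
          _ = D m / √(D m / n) * √ρ := by field_simp
          _ = n * √(D m / n) * √ρ := by
            congr 1
            rw [div_eq_iff hdn.ne', mul_assoc, Real.mul_self_sqrt (by positivity)]
            field_simp
      have h2 : T * (K * √(D m / n) / 2) * √ρ = n * √(D m / n) * √ρ / 2 := by
        rw [hn_eq]; ring
      have h3 : 0 ≤ n * √(D m / n) * √ρ := by positivity
      rw [h2, e_n]
      linarith)
  have hη : τ.η = 1 / √T := by rw [hτ]; rfl
  have hsum := sum_R_mul_sqrt_β_le hT hn hc hD
  have hdiv := R_div_sqrt_β_le hT hn hc hD m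
  rw [← hτ] at hsum hdiv
  have hMT : √(M : ℝ) * √T ≤ √(M * n) := by
    rw [← Real.sqrt_mul (by positivity)]
    have : (1 : ℝ) ≤ K := by
      have : 0 < K := by exact_mod_cast hK
      exact_mod_cast this
    refine Real.sqrt_le_sqrt ?_
    rw [hn_eq]
    have : (T : ℝ) ≤ K * T := le_mul_of_one_le_left hT.le this
    gcongr
  have e1 : 2 * √(M : ℝ) / τ.η = 2 * (√M * √T) := by rw [hη]; field_simp
  have e2 : ∑ i, 4 * τ.R i * √(τ.β i) = 4 * ∑ i, τ.R i * √(τ.β i) := by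
    rw [Finset.mul_sum]
    exact Finset.sum_congr rfl fun i _ => by ring
  have e3 : T * (τ.η * √M + 2 * τ.η ^ 2 * ∑ j, τ.R j * √(τ.β j)) =
      √M * √T + 2 * ∑ j, τ.R j * √(τ.β j) := by
    rw [hη, div_pow, hηT]
    have : (T : ℝ) * (1 / √T) = √T := by nth_rewrite 1 [← hηT]; field_simp
    calc _ = (T * (1 / √T)) * √M + T * (1 / T) * 2 * ∑ j, τ.R j * √(τ.β j) := by ring
      _ = _ := by rw [this]; field_simp
  rw [e1, e2, e3] at h
  linarith

end HedgedBandit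

theorem mainTheorem6 :
    ∃ (C : ℝ) (d : ℕ), 0 < C ∧
      ∀ (K M T : ℕ) (c : ℝ), 0 < c →
      ∀ (X : Type*) [MeasurableSpace X] (P : Fin M → Finset (X → Fin K))
        (hne : ∀ m, (P m).Nonempty) (_ : ∀ m, ∀ π ∈ P m, Measurable π),
      ∃ τ : HedgedBandit.Tuning M,
        ∀ (Ω : Type*) [MeasurableSpace Ω] (μ : MeasureTheory.Measure Ω)
          [MeasureTheory.IsProbabilityMeasure μ] (I : HedgedBandit.Interaction μ T τ P)
          (m : Fin M), (2 ≤ (P m).card ∨ 1 ≤ c) →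
          I.regret (P m) (hne m) ≤
            C * (1 + Real.log T + Real.log K) ^ d *
              (max c (Real.log (P m).card / c) * √((M : ℝ) * K * T)) := by
  -- With `A` the maximum in the claim, `3 + 12 * c + 2 * max c ((1 + L) / c) ≤ 6 * A + 12 * A + 6 *
  -- A`.
  refine ⟨24, 0, by norm_num, fun K M T c hc X _ P hne hmeas => ?_⟩
  rcases Nat.eq_zero_or_pos (K * T) with h0 | h0
  · refine ⟨HedgedBandit.trivialTuning M, fun Ω _ μ _ I m _ => ?_⟩
    refine Finset.sup'_le _ _ fun π _ => ?_
    -- A probability space is nonempty, so no interaction exists with `K = 0`.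
    have hT : T = 0 := by
      rcases Nat.mul_eq_zero.mp h0 with h | h
      · obtain ⟨ω⟩ := nonempty_of_isProbabilityMeasure μ
        subst h
        exact (I.arm 0 ω).elim0
      · exact h
    subst hT
    simp
  have hn : (0 : ℝ) < K * T := by exact_mod_cast h0
  have hT : (0 : ℝ) < T := by exact_mod_cast Nat.pos_of_mul_pos_left h0
  have hlog : ∀ m, 0 ≤ Real.log (P m).card := fun m => Real.log_natCast_nonneg _
  -- The added `1` keeps the complexity positive for a class with a single policy.
  refine ⟨HedgedBandit.paretoTuning T (K * T) c (fun m => 1 + Real.log (P m).card) hT hn hc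
    fun m => by have := hlog m; linarith, fun Ω _ μ _ I m hm => ?_⟩
  refine Finset.sup'_le _ _ fun π hπ => ?_
  refine (I.integral_regret_paretoTuning_le hne hT rfl hn hc _ rfl (by linarith) hπ
    (hmeas m π hπ)).trans ?_
  set L := Real.log (P m).card with hL
  have hL0 : 0 ≤ L := hlog m
  set A := max c (L / c) with hA
  have hcA : c ≤ A := le_max_left _ _
  have hLA : L / c ≤ A := le_max_right _ _
  -- The additive constants must be absorbed into `A`. If the class has two policies, `L ≥ 1/2` and
  -- `A² ≥ c * (L / c) = L`; if `c ≥ 1`, already `A ≥ 1`.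
  have hbounds : 1 ≤ 2 * A ∧ max c ((1 + L) / c) ≤ 3 * A := by
    rcases hm with hm | hm
    · have hL2 : 1 / 2 ≤ L := by
        have h1 : Real.log 2 ≤ L := Real.log_le_log (by norm_num) (by exact_mod_cast hm)
        have := Real.log_two_gt_d9
        linarith
      have h2 : L ≤ A ^ 2 := by
        calc L = c * (L / c) := by field_simp
          _ ≤ A * A := by gcongr
          _ = A ^ 2 := by ring
      refine ⟨by nlinarith, max_le (by linarith) ?_⟩
      calc (1 + L) / c ≤ 3 * L / c := by gcongr; linarith
        _ = 3 * (L / c) := by ring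
        _ ≤ 3 * A := by linarith
    · refine ⟨by linarith, max_le (by linarith) ?_⟩
      have : 1 / c ≤ 1 := by rw [div_le_one hc]; exact hm
      rw [add_div]
      linarith
  have hs : √((M : ℝ) * (K * T)) = √((M : ℝ) * K * T) := by rw [mul_assoc]
  rw [hs, pow_zero, mul_one, ← mul_assoc]
  gcongr
  linarith [hbounds.1, hbounds.2]
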